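/- An $\ell$-group is a group with a lattice order such that $a\le b$ implies $sat\le sbt$; a partially ordered group is defined in the same way with a partial order. A variety of $\ell$-groups is a class of $\ell$-groups defined by identities. Write $\mathrm e$ for the identity element, and let $G$ be a partially ordered group and $\mathsf V$ a variety of $\ell$-groups. A pre-cone of $G$ is a submonoid $C\subsetneq G$ with $G=C\cup C^{-1}$ and $G^+:=\{a\in G\mid a\ge \mathrm e\}\subseteq C$; it is identified with the right pre-order $a\preceq_C b\iff ba^{-1}\in C$. Let $\Omega_C$ be the chain of equivalence classes $[a]$ of the relation "$a\preceq_C b$ and $b\preceq_C a$", ordered by $[a]\le[b]\iff a\preceq_C b$. Its order-preserving permutations form an $\ell$-group $\mathrm{Aut}(\Omega_C)$ (with product $f\cdot g$ = "$g$ after $f$" and point-wise order), and $H_C$ denotes the $\ell$-subgroup (sublattice subgroup) of $\mathrm{Aut}(\Omega_C)$ generated by the maps $[b]\mapsto[ba]$, $a\in G$. Let $\mathcal P_G(\mathsf V)$ be the set of pre-cones $C$ of $G$ with $H_C\in\mathsf V$, with the smallest topology in which all sets $\{C\mid a\in C,\ a^{-1}\notin C\}$, $a\in G$, are open. Its minimal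 layer is the subspace of its inclusion-minimal elements. Let $H=F_{\mathsf V}(G)$ be the $\ell$-group freely generated by $G$ in $\mathsf V$, i.e. the value at $G$ of the left adjoint of the forgetful functor from $\mathsf V$ to partially ordered groups and order-preserving homomorphisms. A prime subgroup of $H$ is an order-convex $\ell$-subgroup $\mathfrak p\ne H$ whose right cosets are totally ordered by $\mathfrak p x\le\mathfrak p y\iff x\le ty$ for some $t\in\mathfrak p$. The set $\mathrm{Spec}\,H$ of prime subgroups carries the topology with open sets $\{\mathfrak p\mid A\not\subseteq\mathfrak p\}$, $A\subseteq H$, and $\mathrm{Min}\,H$ is the subspace of inclusion-minimal prime subgroups. Put $|x|=x\vee x^{-1}$ and $S^\perp=\{x\in H\mid |x|\wedge|y|=\mathrm e\text{ for all }y\in S\}$ for $S\subseteq H$. Let $\mathrm{Pol}\,H$ be the set of polars, that is, of the $T\subseteq H$ with $T=T^{\perp\perp}$; ordered by inclusion it is a Boolean algebra, with complement $T\mapsto T^\perp$. Let $\mathrm{Pol}_{\mathrm p}H=\{\{x\}^{\perp\perp}\mid x\in H\}$. A weak unit of $H$ is an element $w\ge\mathrm e$ such that $w\wedge|x|=\mathrm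 e$ implies $x=\mathrm e$, for all $x\in H$. **Corollary.** For every partially ordered group $G$ and every variety $\mathsf V$ of $\ell$-groups, the minimal layer of $\mathcal P_G(\mathsf V)$ is compact if and only if any one of the following conditions holds for $H=F_{\mathsf V}(G)$; that is, its compactness is equivalent to each of them: 1. $\mathrm{Pol}_{\mathrm p}H$ is a Boolean subalgebra of $\mathrm{Pol}\,H$; 2. $\mathrm{Min}\,H$ is compact; 3. for every $x\in H$ with $x\ge\mathrm e$ there is $y\in H$ with $y\ge\mathrm e$ such that $x\wedge y=\mathrm e$ and $x\vee y$ is a weak unit. -/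

import Mathlib

/-!
Conventions.  A *partially ordered group* is a (multiplicative) group `G` with a partial order
such that multiplication on either side is monotone: `[Group G] [PartialOrder G] [MulLeftMono G]
[MulRightMono G]`.  An *ℓ-group* is the same with a lattice order: `[Group H] [Lattice H]
[MulLeftMono H] [MulRightMono H]`.  The absolute value `x ⊔ x⁻¹` is Mathlib's `|x|ₘ`.
-/

namespace OrderedGroups

universe u v

/-! ### Terms, identities, and varieties of ℓ-groups -/

/-- Terms in the language of ℓ-groups with variables in `X`. -/
inductive LTerm (X : Type u) : Type u
  | var : X → LTerm X
  | one : LTerm X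
  | mul : LTerm X → LTerm X → LTerm X
  | inv : LTerm X → LTerm X
  | sup : LTerm X → LTerm X → LTerm X
  | inf : LTerm X → LTerm X → LTerm X

namespace LTerm

/-- The value of a term under an assignment of the variables. -/
def eval {X : Type u} {H : Type v} [Group H] [Lattice H] (f : X → H) : LTerm X → H
  | var x => f x
  | one => 1
  | mul s t => eval f s * eval f t
  | inv s => (eval f s)⁻¹
  | sup s t => eval f s ⊔ eval f t
  | inf s t => eval f s ⊓ eval f t

/-- Simultaneous substitution of terms for variables. -/
def subst {X : Type u} {Y : Type v} (f : X → LTerm Y) : LTerm X → LTerm Y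
  | var x => f x
  | one => one
  | mul s t => mul (subst f s) (subst f t)
  | inv s => inv (subst f s)
  | sup s t => sup (subst f s) (subst f t)
  | inf s t => inf (subst f s) (subst f t)

theorem eval_subst {X : Type*} {Y : Type*} {H : Type*} [Group H] [Lattice H]
    (f : X → LTerm Y) (g : Y → H) (t : LTerm X) :
    (t.subst f).eval g = t.eval (fun x => (f x).eval g) := by
  induction t <;> simp_all [subst, eval]

end LTerm

/-- A variety (equationally definable class) of ℓ-groups, presented by a set of identities
`s ≈ t` in countably many variables. -/
structure LVariety where
  identities : Set (LTerm ℕ × LTerm ℕ)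

/-- The ℓ-group `H` belongs to the variety `V`: it satisfies all identities of `V`. -/
def LVariety.Mem (V : LVariety) (H : Type v) [Group H] [Lattice H] : Prop :=
  ∀ e ∈ V.identities, ∀ f : ℕ → H, e.1.eval f = e.2.eval f

/-! ### The free ℓ-group over a partially ordered group in a variety -/

section Free

variable (V : LVariety) (G : Type u) [Group G] [PartialOrder G]

/-- The congruence on terms over `G` generated by the axioms of ℓ-groups, the identities of `V`,
and the relations which make the inclusion of `G` a positive group homomorphism. -/
inductive FreeRel : LTerm G → LTerm G → Prop
  | refl (x) : FreeRel x x
  | symm {x y} : FreeRel x y → FreeRel y x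
  | trans {x y z} : FreeRel x y → FreeRel y z → FreeRel x z
  | mul_congr {x x' y y'} : FreeRel x x' → FreeRel y y' → FreeRel (.mul x y) (.mul x' y')
  | inv_congr {x x'} : FreeRel x x' → FreeRel (.inv x) (.inv x')
  | sup_congr {x x' y y'} : FreeRel x x' → FreeRel y y' → FreeRel (.sup x y) (.sup x' y')
  | inf_congr {x x' y y'} : FreeRel x x' → FreeRel y y' → FreeRel (.inf x y) (.inf x' y')
  | mul_assoc (x y z) : FreeRel (.mul (.mul x y) z) (.mul x (.mul y z))
  | one_mul (x) : FreeRel (.mul .one x) x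
  | inv_mul (x) : FreeRel (.mul (.inv x) x) .one
  | sup_comm (x y) : FreeRel (.sup x y) (.sup y x)
  | sup_assoc (x y z) : FreeRel (.sup (.sup x y) z) (.sup x (.sup y z))
  | inf_comm (x y) : FreeRel (.inf x y) (.inf y x)
  | inf_assoc (x y z) : FreeRel (.inf (.inf x y) z) (.inf x (.inf y z))
  | sup_inf_self (x y) : FreeRel (.sup x (.inf x y)) x
  | inf_sup_self (x y) : FreeRel (.inf x (.sup x y)) x
  | mul_sup (x y z) : FreeRel (.mul x (.sup y z)) (.sup (.mul x y) (.mul x z))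
  | sup_mul (x y z) : FreeRel (.mul (.sup x y) z) (.sup (.mul x z) (.mul y z))
  | identity (e : LTerm ℕ × LTerm ℕ) (he : e ∈ V.identities) (f : ℕ → LTerm G) :
      FreeRel (e.1.subst f) (e.2.subst f)
  | gen_mul (a b : G) : FreeRel (.var (a * b)) (.mul (.var a) (.var b))
  | gen_le (a b : G) (hab : a ≤ b) : FreeRel (.sup (.var a) (.var b)) (.var b)

/-- `FreeRel` as a setoid. -/
def freeSetoid : Setoid (LTerm G) where
  r := FreeRel V G
  iseqv := ⟨.refl, .symm, .trans⟩

/-- The ℓ-group freely generated by the partially ordered group `G` in the variety `V`. -/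
def FreeLGroup : Type u := Quotient (freeSetoid V G)

namespace FreeLGroup

variable {V G}

/-- The class of a term. -/
def mk (t : LTerm G) : FreeLGroup V G := Quotient.mk (freeSetoid V G) t

theorem sound {s t : LTerm G} (h : FreeRel V G s t) : (mk s : FreeLGroup V G) = mk t :=
  Quotient.sound (s := freeSetoid V G) h

theorem mk_surjective (x : FreeLGroup V G) : ∃ t, mk t = x :=
  Quotient.exists_rep x

instance : Mul (FreeLGroup V G) :=
  ⟨Quotient.map₂ (sa := freeSetoid V G) (sb := freeSetoid V G) (sc := freeSetoid V G)
    LTerm.mul (fun _ _ h _ _ h' => FreeRel.mul_congr h h')⟩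

instance : Inv (FreeLGroup V G) :=
  ⟨Quotient.map (sa := freeSetoid V G) (sb := freeSetoid V G)
    LTerm.inv (fun _ _ h => FreeRel.inv_congr h)⟩

instance : One (FreeLGroup V G) := ⟨mk LTerm.one⟩

instance : Max (FreeLGroup V G) :=
  ⟨Quotient.map₂ (sa := freeSetoid V G) (sb := freeSetoid V G) (sc := freeSetoid V G)
    LTerm.sup (fun _ _ h _ _ h' => FreeRel.sup_congr h h')⟩

instance : Min (FreeLGroup V G) :=
  ⟨Quotient.map₂ (sa := freeSetoid V G) (sb := freeSetoid V G) (sc := freeSetoid V G)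
    LTerm.inf (fun _ _ h _ _ h' => FreeRel.inf_congr h h')⟩

instance : Group (FreeLGroup V G) :=
  Group.ofLeftAxioms
    (by rintro ⟨x⟩ ⟨y⟩ ⟨z⟩; exact sound (.mul_assoc x y z))
    (by rintro ⟨x⟩; exact sound (.one_mul x))
    (by rintro ⟨x⟩; exact sound (.inv_mul x))

/-- The lattice order is `x ≤ y ↔ x ⊔ y = y`. -/
instance : Lattice (FreeLGroup V G) :=
  Lattice.mk'
    (by rintro ⟨x⟩ ⟨y⟩; exact sound (.sup_comm x y))
    (by rintro ⟨x⟩ ⟨y⟩ ⟨z⟩; exact sound (.sup_assoc x y z))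
    (by rintro ⟨x⟩ ⟨y⟩; exact sound (.inf_comm x y))
    (by rintro ⟨x⟩ ⟨y⟩ ⟨z⟩; exact sound (.inf_assoc x y z))
    (by rintro ⟨x⟩ ⟨y⟩; exact sound (.sup_inf_self x y))
    (by rintro ⟨x⟩ ⟨y⟩; exact sound (.inf_sup_self x y))

theorem mul_sup' (x y z : FreeLGroup V G) : x * (y ⊔ z) = x * y ⊔ x * z := by
  revert x y z
  rintro ⟨x⟩ ⟨y⟩ ⟨z⟩
  exact sound (.mul_sup x y z)

theorem sup_mul' (x y z : FreeLGroup V G) : (x ⊔ y) * z = x * z ⊔ y * z := by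
  revert x y z
  rintro ⟨x⟩ ⟨y⟩ ⟨z⟩
  exact sound (.sup_mul x y z)

instance : MulLeftMono (FreeLGroup V G) := ⟨fun x y z h =>
  sup_eq_right.1 ((mul_sup' x y z).symm.trans (congrArg (x * ·) (sup_eq_right.2 h)))⟩

instance : MulRightMono (FreeLGroup V G) := ⟨fun x y z h =>
  sup_eq_right.1 ((sup_mul' y z x).symm.trans (congrArg (· * x) (sup_eq_right.2 h)))⟩

/-- The universal map `η : G → F_V(G)`. -/
def eta : G →* FreeLGroup V G :=
  MonoidHom.mk' (fun a => mk (.var a)) (fun a b => sound (.gen_mul a b))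

theorem eta_monotone : Monotone (eta : G →* FreeLGroup V G) := fun a b hab =>
  sup_eq_right.1 (sound (.gen_le a b hab))

theorem eval_mk {X : Type*} (f : X → LTerm G) (t : LTerm X) :
    t.eval (fun x => (mk (f x) : FreeLGroup V G)) = mk (t.subst f) := by
  induction t with
  | var x => rfl
  | one => rfl
  | mul s t hs ht => rw [LTerm.eval, hs, ht]; rfl
  | inv s hs => rw [LTerm.eval, hs]; rfl
  | sup s t hs ht => rw [LTerm.eval, hs, ht]; rfl
  | inf s t hs ht => rw [LTerm.eval, hs, ht]; rfl

variable (V G) in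
/-- The free ℓ-group in `V` is a member of `V`. -/
theorem mem_variety : V.Mem (FreeLGroup V G) := by
  intro e he f
  choose g hg using fun n => mk_surjective (f n)
  obtain rfl : (fun n => mk (g n)) = f := funext hg
  rw [eval_mk, eval_mk]
  exact sound (.identity e he g)

theorem eval_eq_of_rel {H : Type v} [Group H] [Lattice H] [MulLeftMono H] [MulRightMono H]
    (hH : V.Mem H) (p : G →* H) (hp : Monotone p) {s t : LTerm G} (h : FreeRel V G s t) :
    s.eval p = t.eval p := by
  induction h with
  | refl => rfl
  | symm _ ih => exact ih.symm
  | trans _ _ ih ih' => exact ih.trans ih'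
  | mul_congr _ _ ih ih' => simp only [LTerm.eval, ih, ih']
  | inv_congr _ ih => simp only [LTerm.eval, ih]
  | sup_congr _ _ ih ih' => simp only [LTerm.eval, ih, ih']
  | inf_congr _ _ ih ih' => simp only [LTerm.eval, ih, ih']
  | mul_assoc => exact _root_.mul_assoc _ _ _
  | one_mul => exact _root_.one_mul _
  | inv_mul => exact inv_mul_cancel _
  | sup_comm => exact _root_.sup_comm _ _
  | sup_assoc => exact _root_.sup_assoc _ _ _
  | inf_comm => exact _root_.inf_comm _ _
  | inf_assoc => exact _root_.inf_assoc _ _ _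
  | sup_inf_self => exact _root_.sup_inf_self
  | inf_sup_self => exact _root_.inf_sup_self
  | mul_sup => exact _root_.mul_sup _ _ _
  | sup_mul => exact _root_.sup_mul _ _ _
  | identity e he f => rw [LTerm.eval_subst, LTerm.eval_subst]; exact hH e he _
  | gen_mul a b => exact map_mul p a b
  | gen_le a b hab => exact sup_eq_right.2 (hp hab)

/-- The universal property of `η : G → F_V(G)`. -/
theorem existsUnique_lift {H : Type v} [Group H] [Lattice H] [MulLeftMono H] [MulRightMono H]
    (hH : V.Mem H) (p : G →* H) (hp : Monotone p) :
    ∃! h : FreeLGroup V G →* H, (∀ x y, h (x ⊔ y) = h x ⊔ h y) ∧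
      (∀ x y, h (x ⊓ y) = h x ⊓ h y) ∧ ∀ a, h (eta a) = p a := by
  let φ : FreeLGroup V G → H :=
    Quotient.lift (s := freeSetoid V G) (fun t => t.eval p) (fun _ _ h => eval_eq_of_rel hH p hp h)
  refine ⟨MonoidHom.mk' φ (by rintro ⟨x⟩ ⟨y⟩; rfl), ⟨?_, ?_, fun a => rfl⟩, ?_⟩
  · rintro ⟨x⟩ ⟨y⟩; rfl
  · rintro ⟨x⟩ ⟨y⟩; rfl
  · rintro h ⟨hs, hi, ha⟩
    ext x
    obtain ⟨t, rfl⟩ := mk_surjective x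
    change h (mk t) = t.eval p
    induction t with
    | var a => exact ha a
    | one => exact map_one h
    | mul s t ihs iht => rw [LTerm.eval, ← ihs, ← iht, ← map_mul]; rfl
    | inv s ihs => rw [LTerm.eval, ← ihs, ← map_inv]; rfl
    | sup s t ihs iht => rw [LTerm.eval, ← ihs, ← iht, ← hs]; rfl
    | inf s t ihs iht => rw [LTerm.eval, ← ihs, ← iht, ← hi]; rfl

end FreeLGroup

end Free

/-! ### ℓ-subgroups -/

/-- An ℓ-subgroup: a subgroup which is also a sublattice. -/
structure LSubgroup (H : Type u) [Group H] [Lattice H] extends Subgroup H, Sublattice H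

namespace LSubgroup

variable {H : Type u} [Group H] [Lattice H]

instance : SetLike (LSubgroup H) H where
  coe K := K.carrier
  coe_injective := by
    rintro ⟨⟨⟨⟨_, _⟩, _⟩, _⟩, _, _⟩ ⟨⟨⟨⟨_, _⟩, _⟩, _⟩, _, _⟩ h
    cases h
    rfl

instance : SubgroupClass (LSubgroup H) H where
  mul_mem {K} := K.mul_mem'
  one_mem K := K.one_mem'
  inv_mem {K} := K.inv_mem'

/-- An ℓ-subgroup is a lattice under the induced order, with the lattice operations of `H`. -/
instance (K : LSubgroup H) : Lattice K :=
  Subtype.lattice (fun _ _ hx hy => K.supClosed' hx hy) (fun _ _ hx hy => K.infClosed' hx hy)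

/-- The ℓ-subgroup generated by a set: the intersection of all ℓ-subgroups containing it. -/
def closure (S : Set H) : LSubgroup H where
  carrier := {x | ∀ K : LSubgroup H, S ⊆ (K : Set H) → x ∈ K}
  mul_mem' hx hy K hK := mul_mem (hx K hK) (hy K hK)
  one_mem' K _ := one_mem K
  inv_mem' hx K hK := inv_mem (hx K hK)
  supClosed' _ hx _ hy K hK := K.supClosed' (hx K hK) (hy K hK)
  infClosed' _ hx _ hy K hK := K.infClosed' (hx K hK) (hy K hK)

end LSubgroup

/-! ### The ℓ-group of automorphisms of a chain -/

/-- The order-preserving permutations of a chain `Ω`. -/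
def ChainAut (Ω : Type u) [LinearOrder Ω] : Type u := Ω ≃o Ω

namespace ChainAut

variable {Ω : Type u} [LinearOrder Ω]

instance : FunLike (ChainAut Ω) Ω Ω := inferInstanceAs (FunLike (Ω ≃o Ω) Ω Ω)

/-- The product `f * g` is `g` after `f`. -/
instance : Group (ChainAut Ω) where
  mul f g := OrderIso.trans f g
  one := OrderIso.refl Ω
  inv f := OrderIso.symm f
  mul_assoc _ _ _ := rfl
  one_mul _ := rfl
  mul_one _ := rfl
  inv_mul_cancel f := OrderIso.symm_trans_self f

/-- The order is point-wise. -/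
instance : PartialOrder (ChainAut Ω) :=
  PartialOrder.lift (fun f : ChainAut Ω => (f : Ω → Ω)) DFunLike.coe_injective

/-- The point-wise maximum of two order automorphisms. -/
def sup (f g : ChainAut Ω) : ChainAut Ω :=
  StrictMono.orderIsoOfRightInverse (fun x => f x ⊔ g x)
    (fun _ _ h => max_lt_max (OrderIso.strictMono f h) (OrderIso.strictMono g h))
    (fun x => OrderIso.symm f x ⊓ OrderIso.symm g x)
    (fun x => by
      apply le_antisymm
      · refine sup_le ?_ ?_
        · exact ((OrderIso.monotone f) inf_le_left).trans_eq (OrderIso.apply_symm_apply f x)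
        · exact ((OrderIso.monotone g) inf_le_right).trans_eq (OrderIso.apply_symm_apply g x)
      · rcases le_total (OrderIso.symm f x) (OrderIso.symm g x) with h | h
        · simp only [inf_eq_left.2 h]
          exact le_sup_of_le_left (OrderIso.apply_symm_apply f x).ge
        · simp only [inf_eq_right.2 h]
          exact le_sup_of_le_right (OrderIso.apply_symm_apply g x).ge)

/-- The point-wise minimum of two order automorphisms. -/
def inf (f g : ChainAut Ω) : ChainAut Ω :=
  StrictMono.orderIsoOfRightInverse (fun x => f x ⊓ g x)
    (fun _ _ h => min_lt_min (OrderIso.strictMono f h) (OrderIso.strictMono g h))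
    (fun x => OrderIso.symm f x ⊔ OrderIso.symm g x)
    (fun x => by
      apply le_antisymm
      · rcases le_total (OrderIso.symm f x) (OrderIso.symm g x) with h | h
        · simp only [sup_eq_right.2 h]
          exact inf_le_of_right_le (OrderIso.apply_symm_apply g x).le
        · simp only [sup_eq_left.2 h]
          exact inf_le_of_left_le (OrderIso.apply_symm_apply f x).le
      · refine le_inf ?_ ?_
        · exact (OrderIso.apply_symm_apply f x).symm.trans_le ((OrderIso.monotone f) le_sup_left)
        · exact (OrderIso.apply_symm_apply g x).symm.trans_le ((OrderIso.monotone g) le_sup_right))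

instance : Lattice (ChainAut Ω) where
  sup := sup
  inf := inf
  le_sup_left f g x := le_sup_left (a := f x) (b := g x)
  le_sup_right f g x := le_sup_right (a := f x) (b := g x)
  sup_le _ _ _ h h' x := sup_le (h x) (h' x)
  inf_le_left f g x := inf_le_left (a := f x) (b := g x)
  inf_le_right f g x := inf_le_right (a := f x) (b := g x)
  le_inf _ _ _ h h' x := le_inf (h x) (h' x)

instance : MulLeftMono (ChainAut Ω) := ⟨fun f _ _ h x => h (f x)⟩

instance : MulRightMono (ChainAut Ω) := ⟨fun f _ _ h x => OrderIso.monotone f (h x)⟩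

end ChainAut

/-! ### Right pre-orders and the right regular representation -/

/-- A pre-cone of a partially ordered group `G`: a proper submonoid `C` with `G = C ∪ C⁻¹` and
`G⁺ ⊆ C`.  It is identified with the right pre-order `a ≼ b ↔ b * a⁻¹ ∈ C`. -/
structure PreCone (G : Type u) [Group G] [PartialOrder G] extends Submonoid G where
  total' : ∀ a : G, a ∈ carrier ∨ a⁻¹ ∈ carrier
  pos' : ∀ a : G, 1 ≤ a → a ∈ carrier
  proper' : carrier ≠ Set.univ

namespace PreCone

variable {G : Type u} [Group G] [PartialOrder G]

instance : SetLike (PreCone G) G where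
  coe C := C.carrier
  coe_injective := by
    rintro ⟨⟨⟨_, _⟩, _⟩, _, _, _⟩ ⟨⟨⟨_, _⟩, _⟩, _, _, _⟩ h
    cases h
    rfl

instance : SubmonoidClass (PreCone G) G where
  mul_mem {C} := C.mul_mem'
  one_mem C := C.one_mem'

/-- Pre-cones are ordered by inclusion. -/
instance : PartialOrder (PreCone G) := PartialOrder.ofSetLike (PreCone G) G

/-- The right pre-order associated with a pre-cone. -/
def Le (C : PreCone G) (a b : G) : Prop := b * a⁻¹ ∈ C

variable (C : PreCone G)

theorem le_refl (a : G) : C.Le a a := by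
  simp [Le]

variable {C} in
theorem Le.trans {a b c : G} (h : C.Le a b) (h' : C.Le b c) : C.Le a c := by
  simpa [Le] using mul_mem h' h

theorem le_total (a b : G) : C.Le a b ∨ C.Le b a := by
  have h := C.total' (b * a⁻¹)
  rwa [mul_inv_rev, inv_inv] at h

theorem mul_right_le_iff {a b : G} (t : G) : C.Le (a * t) (b * t) ↔ C.Le a b := by
  simp [Le, _root_.mul_assoc]

/-- The equivalence relation `a ≡ b ↔ a ≼ b ∧ b ≼ a`. -/
def setoid : Setoid G where
  r a b := C.Le a b ∧ C.Le b a
  iseqv := ⟨fun a => ⟨C.le_refl a, C.le_refl a⟩, fun h => ⟨h.2, h.1⟩,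
    fun h h' => ⟨h.1.trans h'.1, h'.2.trans h.2⟩⟩

/-- The chain `Ω_C` of equivalence classes. -/
def Omega : Type u := Quotient C.setoid

/-- The class `[a]` of `a`. -/
def cls (a : G) : C.Omega := Quotient.mk C.setoid a

/-- `Ω_C` is totally ordered by `[a] ≤ [b] ↔ a ≼ b`. -/
noncomputable instance : LinearOrder C.Omega where
  le := Quotient.lift₂ (s₁ := C.setoid) (s₂ := C.setoid) C.Le (fun _ _ _ _ h h' =>
    propext ⟨fun k => (h.2.trans k).trans h'.1, fun k => (h.1.trans k).trans h'.2⟩)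
  le_refl := by rintro ⟨a⟩; exact C.le_refl a
  le_trans := by rintro ⟨a⟩ ⟨b⟩ ⟨c⟩ h h'; exact Le.trans h h'
  le_antisymm := by rintro ⟨a⟩ ⟨b⟩ h h'; exact Quotient.sound (s := C.setoid) ⟨h, h'⟩
  le_total := by rintro ⟨a⟩ ⟨b⟩; exact C.le_total a b
  toDecidableLE := Classical.decRel _

theorem cls_le_cls {a b : G} : C.cls a ≤ C.cls b ↔ C.Le a b := Iff.rfl

/-- Right translation `[b] ↦ [b * a]` as a map on `Ω_C`. -/
def translate (a : G) : C.Omega → C.Omega :=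
  Quotient.map (sa := C.setoid) (sb := C.setoid) (fun b => b * a)
    (fun _ _ h => ⟨(C.mul_right_le_iff a).2 h.1, (C.mul_right_le_iff a).2 h.2⟩)

/-- The right regular representation `ρ_C(a) : [b] ↦ [b * a]`. -/
noncomputable def rho : G →* ChainAut C.Omega :=
  MonoidHom.mk'
    (fun a =>
      { toFun := C.translate a
        invFun := C.translate a⁻¹
        left_inv := by
          rintro ⟨b⟩
          exact congrArg C.cls (mul_inv_cancel_right b a)
        right_inv := by
          rintro ⟨b⟩
          exact congrArg C.cls (inv_mul_cancel_right b a)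
        map_rel_iff' := by
          rintro ⟨b⟩ ⟨c⟩
          exact C.mul_right_le_iff a } : G → (C.Omega ≃o C.Omega))
    (fun a b => by
      refine DFunLike.ext (F := C.Omega ≃o C.Omega) _ _ ?_
      rintro ⟨c⟩
      exact congrArg C.cls (_root_.mul_assoc c a b).symm)

theorem rho_apply (a b : G) : C.rho a (C.cls b) = C.cls (b * a) := rfl

/-- `H_C`: the ℓ-subgroup of `Aut(Ω_C)` generated by the image of the regular representation. -/
noncomputable def H : LSubgroup (ChainAut C.Omega) := LSubgroup.closure (Set.range C.rho)

end PreCone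

/-- The set of right pre-orders of the variety `V` on `G`: the pre-cones `C` with `H_C ∈ V`. -/
def VPreorders (V : LVariety) (G : Type u) [Group G] [PartialOrder G] : Type u :=
  {C : PreCone G // V.Mem C.H}

namespace VPreorders

variable {V : LVariety} {G : Type u} [Group G] [PartialOrder G]

/-- The set `ℙ(a)` of those `C` with `a ∈ C` and `a⁻¹ ∉ C`. -/
def basicOpen (a : G) : Set (VPreorders V G) := {C | a ∈ C.1 ∧ a⁻¹ ∉ C.1}

/-- The smallest topology containing all the sets `ℙ(a)`. -/
instance : TopologicalSpace (VPreorders V G) :=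
  TopologicalSpace.generateFrom (Set.range basicOpen)

/-- The inclusion order. -/
instance : PartialOrder (VPreorders V G) :=
  inferInstanceAs (PartialOrder {C : PreCone G // V.Mem C.H})

variable (V G) in
/-- The minimal layer: the subspace of inclusion-minimal elements. -/
def minimalLayer : Set (VPreorders V G) := {C | IsMin C}

end VPreorders

/-! ### Prime subgroups and the spectral topology -/

/-- A prime (convex ℓ-)subgroup `p` of an ℓ-group `H`: an order-convex ℓ-subgroup which is proper
and such that the right cosets are totally ordered by `p x ≤ p y ↔ ∃ t ∈ p, x ≤ t * y`. -/
structure PrimeSubgroup (H : Type u) [Group H] [Lattice H] extends LSubgroup H where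
  ordConnected' : carrier.OrdConnected
  proper' : carrier ≠ Set.univ
  total' : ∀ x y : H, (∃ t ∈ carrier, x ≤ t * y) ∨ (∃ t ∈ carrier, y ≤ t * x)

namespace PrimeSubgroup

variable {H : Type u} [Group H] [Lattice H]

instance : SetLike (PrimeSubgroup H) H where
  coe p := p.carrier
  coe_injective := by
    rintro ⟨⟨⟨⟨⟨_, _⟩, _⟩, _⟩, _, _⟩, _, _, _⟩ ⟨⟨⟨⟨⟨_, _⟩, _⟩, _⟩, _, _⟩, _, _, _⟩ h
    cases h
    rfl

instance : SubgroupClass (PrimeSubgroup H) H where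
  mul_mem {p} := p.mul_mem'
  one_mem p := p.one_mem'
  inv_mem {p} := p.inv_mem'

/-- Prime subgroups are ordered by inclusion. -/
instance : PartialOrder (PrimeSubgroup H) := PartialOrder.ofSetLike (PrimeSubgroup H) H

/-- The set `𝕊(A)` of the prime subgroups which do not contain `A`. -/
def support (A : Set H) : Set (PrimeSubgroup H) := {p | ¬ A ⊆ (p : Set H)}

variable [MulLeftMono H] [MulRightMono H]

theorem mabs_mem_iff (p : PrimeSubgroup H) {a : H} : |a|ₘ ∈ p ↔ a ∈ p :=
  ⟨fun h => p.ordConnected'.out (inv_mem h) h ⟨inv_le'.1 (inv_le_mabs a), le_mabs_self a⟩,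
    fun h => p.supClosed' h (inv_mem h)⟩

theorem mabs_inf_mabs_mem_iff (p : PrimeSubgroup H) {a b : H} :
    |a|ₘ ⊓ |b|ₘ ∈ p ↔ a ∈ p ∨ b ∈ p := by
  have key : ∀ a b t : H, t ∈ p → |a|ₘ ≤ t * |b|ₘ → |a|ₘ ⊓ |b|ₘ ∈ p → a ∈ p := by
    intro a b t ht hab h
    refine p.mabs_mem_iff.1 (p.ordConnected'.out (one_mem p)
      (mul_mem (p.mabs_mem_iff.2 ht) h) ⟨one_le_mabs a, ?_⟩)
    rw [mul_inf]
    exact le_inf (le_mul_of_one_le_left' (one_le_mabs t))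
      (hab.trans (mul_le_mul_left (le_mabs_self t) _))
  constructor
  · intro h
    rcases p.total' |a|ₘ |b|ₘ with ⟨t, ht, hab⟩ | ⟨t, ht, hab⟩
    · exact Or.inl (key a b t ht hab h)
    · exact Or.inr (key b a t ht hab (by rwa [inf_comm]))
  · have h1 : (1 : H) ≤ |a|ₘ ⊓ |b|ₘ := le_inf (one_le_mabs a) (one_le_mabs b)
    rintro (h | h)
    · exact p.ordConnected'.out (one_mem p) (p.mabs_mem_iff.2 h) ⟨h1, inf_le_left⟩
    · exact p.ordConnected'.out (one_mem p) (p.mabs_mem_iff.2 h) ⟨h1, inf_le_right⟩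

/-- The spectral (Zariski) topology: the open sets are the sets `𝕊(A)`, for `A ⊆ H`. -/
instance : TopologicalSpace (PrimeSubgroup H) where
  IsOpen U := ∃ A : Set H, U = support A
  isOpen_univ := ⟨Set.univ, by
    ext p
    exact iff_of_true trivial (fun h => p.proper' (Set.univ_subset_iff.1 h))⟩
  isOpen_inter := by
    rintro _ _ ⟨A, rfl⟩ ⟨B, rfl⟩
    refine ⟨Set.image2 (fun a b => |a|ₘ ⊓ |b|ₘ) A B, ?_⟩
    ext p
    constructor
    · rintro ⟨hA, hB⟩ h
      obtain ⟨a, ha, ha'⟩ := Set.not_subset.1 hA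
      obtain ⟨b, hb, hb'⟩ := Set.not_subset.1 hB
      rcases p.mabs_inf_mabs_mem_iff.1 (h ⟨a, ha, b, hb, rfl⟩) with h | h
      · exact ha' h
      · exact hb' h
    · refine fun h => ⟨fun hA => h ?_, fun hB => h ?_⟩
      · rintro _ ⟨a, ha, b, hb, rfl⟩
        exact p.mabs_inf_mabs_mem_iff.2 (Or.inl (hA ha))
      · rintro _ ⟨a, ha, b, hb, rfl⟩
        exact p.mabs_inf_mabs_mem_iff.2 (Or.inr (hB hb))
  isOpen_sUnion := by
    intro S hS
    refine ⟨⋃₀ {A | support A ∈ S}, ?_⟩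
    ext p
    constructor
    · rintro ⟨U, hU, hp⟩ h
      obtain ⟨A, rfl⟩ := hS U hU
      exact hp ((Set.subset_sUnion_of_mem (show A ∈ {A | support A ∈ S} from hU)).trans h)
    · intro h
      by_contra hn
      exact h (Set.sUnion_subset fun A hA => by_contra fun hp => hn ⟨_, hA, hp⟩)

end PrimeSubgroup

/-- The minimal spectrum of `H`: the subspace of inclusion-minimal prime subgroups. -/
def minimalSpectrum (H : Type u) [Group H] [Lattice H] : Set (PrimeSubgroup H) := {p | IsMin p}

/-! ### Polars -/

section Polars

variable {H : Type u} [Group H] [Lattice H]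

/-- `S^⊥`: the set of elements orthogonal to every element of `S`. -/
def perp (S : Set H) : Set H := {x | ∀ y ∈ S, |x|ₘ ⊓ |y|ₘ = 1}

theorem perp_anti {S T : Set H} (h : S ⊆ T) : perp T ⊆ perp S := fun _ hx y hy => hx y (h hy)

theorem subset_perp_perp (S : Set H) : S ⊆ perp (perp S) := fun x hx y hy => by
  rw [inf_comm]; exact hy x hx

theorem perp_perp_perp (S : Set H) : perp (perp (perp S)) = perp S :=
  (perp_anti (subset_perp_perp S)).antisymm (subset_perp_perp _)

variable (H) in
/-- The set `Pol(H)` of polars of `H`: the subsets `T` with `T = T^⊥⊥`. -/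
def Polar : Type u := {T : Set H // perp (perp T) = T}

namespace Polar

/-- Polars are ordered by inclusion. -/
instance : PartialOrder (Polar H) :=
  inferInstanceAs (PartialOrder {T : Set H // perp (perp T) = T})

variable [MulLeftMono H] [MulRightMono H]

theorem mem_perp_of_mabs_le {S : Set H} {x y : H} (hy : y ∈ perp S) (h : |x|ₘ ≤ |y|ₘ) :
    x ∈ perp S := fun z hz =>
  le_antisymm ((inf_le_inf_right _ h).trans_eq (hy z hz)) (le_inf (one_le_mabs x) (one_le_mabs z))

theorem one_mem_perp (S : Set H) : (1 : H) ∈ perp S := fun z _ => by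
  rw [mabs_one]; exact inf_eq_left.2 (one_le_mabs z)

theorem eq_one_of_mem {S : Set H} {x : H} (h : x ∈ S) (h' : x ∈ perp S) : x = 1 := by
  have := h' x h
  rw [inf_idem] at this
  exact le_antisymm (this ▸ le_mabs_self x) (inv_le_one'.1 (this ▸ inv_le_mabs x))

theorem mabs_inf_mabs (x y : H) : |(|x|ₘ ⊓ |y|ₘ)|ₘ = |x|ₘ ⊓ |y|ₘ :=
  mabs_of_one_le (le_inf (one_le_mabs x) (one_le_mabs y))

theorem mem_of_mabs_le (T : Polar H) {x y : H} (hy : y ∈ T.1) (h : |x|ₘ ≤ |y|ₘ) : x ∈ T.1 := by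
  rw [← T.2] at hy ⊢
  exact mem_perp_of_mabs_le hy h

theorem perp_union_inf {A B C : Polar H} {x : H} (hA : x ∈ A.1)
    (hBC : x ∈ perp (perp (B.1 ∪ C.1))) :
    x ∈ perp (perp ((A.1 ∩ B.1) ∪ (A.1 ∩ C.1))) := by
  intro y hy
  set z := |x|ₘ ⊓ |y|ₘ with hz
  have hzz : |z|ₘ = z := mabs_inf_mabs x y
  have hzx : |z|ₘ ≤ |x|ₘ := hzz.trans_le inf_le_left
  have hzy : |z|ₘ ≤ |y|ₘ := hzz.trans_le inf_le_right
  refine eq_one_of_mem (S := perp (B.1 ∪ C.1)) ?_ (mem_perp_of_mabs_le hBC hzx)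
  have aux : ∀ D : Polar H, (A.1 ∩ D.1 ⊆ (A.1 ∩ B.1) ∪ (A.1 ∩ C.1)) → ∀ d ∈ D.1,
      |z|ₘ ⊓ |d|ₘ = 1 := by
    intro D hD d hd
    set w := |z|ₘ ⊓ |d|ₘ with hw
    have hww : |w|ₘ = w := mabs_inf_mabs z d
    have hwA : w ∈ A.1 := A.mem_of_mabs_le hA ((hww.trans_le inf_le_left).trans hzx)
    have hwD : w ∈ D.1 := D.mem_of_mabs_le hd (hww.trans_le inf_le_right)
    have := hy w (hD ⟨hwA, hwD⟩)
    rwa [inf_eq_right.2 ((hww.trans_le inf_le_left).trans hzy), hww] at this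
  rintro d (hd | hd)
  · exact aux B Set.subset_union_left d hd
  · exact aux C Set.subset_union_right d hd

/-- Under inclusion `Pol(H)` is a lattice, with intersections as meets and `(S ∪ T)^⊥⊥` as
joins. -/
instance : Lattice (Polar H) where
  sup S T := ⟨perp (perp (S.1 ∪ T.1)), perp_perp_perp _⟩
  inf S T := ⟨S.1 ∩ T.1, (Set.subset_inter
    ((perp_anti (perp_anti Set.inter_subset_left)).trans S.2.subset)
    ((perp_anti (perp_anti Set.inter_subset_right)).trans T.2.subset)).antisymm
      (subset_perp_perp _)⟩
  le_sup_left S T := Set.subset_union_left.trans (subset_perp_perp (S.1 ∪ T.1))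
  le_sup_right S T := Set.subset_union_right.trans (subset_perp_perp (S.1 ∪ T.1))
  sup_le S T R h h' := (perp_anti (perp_anti (Set.union_subset h h'))).trans R.2.subset
  inf_le_left S T := Set.inter_subset_left (s := S.1) (t := T.1)
  inf_le_right S T := Set.inter_subset_right (s := S.1) (t := T.1)
  le_inf S T R h h' := Set.subset_inter (r := S.1) (s := T.1) (t := R.1) h h'

instance : DistribLattice (Polar H) :=
  DistribLattice.ofInfSupLe (fun A B C x (hx : x ∈ A.1 ∩ perp (perp (B.1 ∪ C.1))) =>
    perp_union_inf (A := A) (B := B) (C := C) hx.1 hx.2)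

/-- `Pol(H)` is a Boolean algebra, with maximum `H`, minimum `{e}`, and complement `T ↦ T^⊥`. -/
instance : BooleanAlgebra (Polar H) where
  top := ⟨Set.univ, Set.eq_univ_of_univ_subset (subset_perp_perp _)⟩
  bot := ⟨{1}, by
    refine Set.Subset.antisymm (fun x hx => ?_) (subset_perp_perp _)
    refine eq_one_of_mem (S := perp {1}) (fun y hy => ?_) hx
    rw [Set.mem_singleton_iff.1 hy, mabs_one]
    exact inf_eq_right.2 (one_le_mabs x)⟩
  compl T := ⟨perp T.1, perp_perp_perp _⟩
  le_top T := Set.subset_univ T.1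
  bot_le T := Set.singleton_subset_iff.2 (T.2 ▸ one_mem_perp (perp T.1))
  inf_compl_le_bot T := fun x (hx : x ∈ T.1 ∩ perp T.1) => Set.mem_singleton_iff.2 (eq_one_of_mem hx.1 hx.2)
  top_le_sup_compl T := fun x _ y hy => by
    have hy1 : y = 1 := eq_one_of_mem (S := perp T.1)
      (perp_anti Set.subset_union_left hy) (perp_anti Set.subset_union_right hy)
    rw [hy1, mabs_one]
    exact inf_eq_right.2 (one_le_mabs x)

end Polar

/-- The principal polar `x^⊥⊥`. -/
def principalPolar (x : H) : Polar H := ⟨perp (perp {x}), perp_perp_perp _⟩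

variable (H) in
/-- The set `Pol_p(H)` of principal polars. -/
def principalPolars : Set (Polar H) := Set.range principalPolar

variable (H) in
/-- `Pol_p(H)` is a Boolean subalgebra of `Pol(H)`. -/
def PrincipalPolarsBoolean [MulLeftMono H] [MulRightMono H] : Prop :=
  ∃ B : BooleanSubalgebra (Polar H), (B : Set (Polar H)) = principalPolars H

/-- A weak (order) unit. -/
def IsWeakUnit (w : H) : Prop := 1 ≤ w ∧ ∀ x : H, w ⊓ |x|ₘ = 1 → x = 1

variable (H) in
/-- `H⁺` is complemented. -/
def PositiveConeComplemented : Prop :=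
  ∀ x : H, 1 ≤ x → ∃ y : H, 1 ≤ y ∧ x ⊓ y = 1 ∧ IsWeakUnit (x ⊔ y)

end Polars

end OrderedGroups

namespace OrderedGroups

universe u v

/-! ### Orthogonality and minimal prime subgroups of an ℓ-group -/

section LGroup

variable {H : Type u} [Group H] [Lattice H]

/-! The proof has two independent halves.

The first identifies $\mathcal P_G(\mathsf V)$ with $\mathrm{Spec}\,H$ (`homeomorphSpectrum`). A
prime $\mathfrak p$ gives the pre-cone of all $a$ with $\mathfrak p\le\mathfrak p\,\eta(a)$; the
chain $\Omega_C$ of this pre-cone describes the cosets $\mathfrak p\,\eta(a)$, and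
`le_of_eval_rho_apply` shows that terms act alike on both, so $H_C$ inherits the identities of $H$.
Conversely, if $H_C\in\mathsf V$, the universal property lets $H$ act on $\Omega_C$, and the
stabilizer of $[\mathrm e]$ is prime. The two constructions are mutually inverse and continuous,
because $\eta(G)$ generates $H$ as a lattice. In both spaces inclusion is the specialization order,
so minimal elements correspond and the minimal layer is homeomorphic to $\mathrm{Min}\,H$.

The second half holds in every ℓ-group. By Zorn, maximal meet-closed sets of positive elements
without $\mathrm e$ produce minimal primes (`exists_isMin_disjoint`); hence each positive element of
a minimal prime is orthogonal to some element outside it, and the minimal primes intersect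
trivially. An ultrafilter argument and a directed cover then make compactness of $\mathrm{Min}\,H$
equivalent to complementation of the positive cone. Finally, $y$ complements $x$ exactly when
$y^{\perp\perp}$ is the Boolean complement of $x^{\perp\perp}$, which settles the condition on
polars. -/

theorem mabs_le_iff_and {x w : H} : |x|ₘ ≤ w ↔ x ≤ w ∧ x⁻¹ ≤ w := sup_le_iff

theorem mem_perp_singleton {x y : H} : x ∈ perp {y} ↔ |x|ₘ ⊓ |y|ₘ = 1 :=
  ⟨fun h => h y rfl, fun h _ hz => by rwa [Set.mem_singleton_iff.1 hz]⟩

namespace PrimeSubgroup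

theorem exists_notMem (p : PrimeSubgroup H) : ∃ x : H, x ∉ p :=
  (Set.ne_univ_iff_exists_notMem _).1 p.proper'

theorem mem_of_le (p : PrimeSubgroup H) {a b : H} (ha : 1 ≤ a) (hab : a ≤ b) (hb : b ∈ p) :
    a ∈ p := p.ordConnected'.out (one_mem p) hb ⟨ha, hab⟩

theorem mem_support_singleton {p : PrimeSubgroup H} {a : H} : p ∈ support {a} ↔ a ∉ p :=
  not_congr Set.singleton_subset_iff

end PrimeSubgroup

variable [MulLeftMono H] [MulRightMono H]

/-- The symmetric product dominates $|x||y|$ and also $|y||x|$, which is needed for $(xy)^{-1}$. It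
is thus a single bound for the absolute values of products, joins, meets and elements between $x$
and $y$. -/
theorem le_mabs_mul_mabs_mul_mabs (x y : H) :
    |x|ₘ ≤ |x|ₘ * |y|ₘ * |x|ₘ ∧ |y|ₘ ≤ |x|ₘ * |y|ₘ * |x|ₘ ∧ |x|ₘ * |y|ₘ ≤ |x|ₘ * |y|ₘ * |x|ₘ ∧
      |y|ₘ * |x|ₘ ≤ |x|ₘ * |y|ₘ * |x|ₘ := by
  have hx := one_le_mabs x
  have hy := one_le_mabs y
  have h1 : |x|ₘ * |y|ₘ ≤ |x|ₘ * |y|ₘ * |x|ₘ := le_mul_of_one_le_right' hx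
  refine ⟨(le_mul_of_one_le_right' hy).trans h1, (le_mul_of_one_le_left' hx).trans h1, h1, ?_⟩
  rw [mul_assoc]
  exact le_mul_of_one_le_left' hx

/-- $a\wedge bc\le ba\wedge bc=b(a\wedge c)=b$, so $a\wedge bc\le a\wedge b$. -/
theorem inf_mul_eq_one {a b c : H} (ha : 1 ≤ a) (hb : 1 ≤ b) (hc : 1 ≤ c)
    (h : a ⊓ b = 1) (h' : a ⊓ c = 1) : a ⊓ (b * c) = 1 := by
  refine le_antisymm ?_ (le_inf ha (one_le_mul hb hc))
  have : a ⊓ (b * c) ≤ b := by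
    calc a ⊓ (b * c) ≤ (b * a) ⊓ (b * c) := inf_le_inf_right _ (le_mul_of_one_le_left' hb)
      _ = b := by rw [← mul_inf, h', mul_one]
  exact (le_inf inf_le_left this).trans h.le

theorem inf_sup_eq_one {a b c : H} (ha : 1 ≤ a) (hb : 1 ≤ b) (hc : 1 ≤ c)
    (h : a ⊓ b = 1) (h' : a ⊓ c = 1) : a ⊓ (b ⊔ c) = 1 :=
  le_antisymm ((inf_le_inf_left _ (sup_le (le_mul_of_one_le_right' hc)
    (le_mul_of_one_le_left' hb))).trans (inf_mul_eq_one ha hb hc h h').le)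
    (le_inf ha (hb.trans le_sup_left))

/-- Positive and negative part are orthogonal: they are $u(u\wedge\mathrm e)^{-1}$ and
$(u\wedge\mathrm e)^{-1}$, so their meet is $(u\wedge\mathrm e)(u\wedge\mathrm e)^{-1}$. -/
theorem sup_one_inf_inv_sup_one (u : H) : (u ⊔ 1) ⊓ (u⁻¹ ⊔ 1) = 1 := by
  refine le_antisymm ?_ (le_inf le_sup_right le_sup_right)
  have h1 : (u⁻¹ ⊔ 1) = (u ⊓ 1)⁻¹ := by rw [inv_inf, inv_one]
  have h2 : (u ⊔ 1) = u * (u ⊓ 1)⁻¹ := by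
    rw [inv_inf, mul_sup, mul_inv_cancel, inv_one, mul_one, sup_comm]
  calc (u ⊔ 1) ⊓ (u⁻¹ ⊔ 1) = (u ⊓ 1) * (u ⊓ 1)⁻¹ := by
        rw [inf_mul, ← h2, one_mul, ← h1]
    _ ≤ 1 := (mul_inv_cancel _).le

namespace PrimeSubgroup

theorem inf_mem_iff (p : PrimeSubgroup H) {a b : H} (ha : 1 ≤ a) (hb : 1 ≤ b) :
    a ⊓ b ∈ p ↔ a ∈ p ∨ b ∈ p := by
  rw [← p.mabs_inf_mabs_mem_iff, mabs_of_one_le ha, mabs_of_one_le hb]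

/-- The minimal prime subgroup defined by a maximal set `B` of strictly positive elements closed
under meets. -/
def ofMaximal (B : Set H) (hne : B.Nonempty) (h1 : ∀ b ∈ B, 1 ≤ b) (hinf : InfClosed B)
    (hB : (1 : H) ∉ B) (hmax : ∀ a, 1 ≤ a → a ∉ B → ∃ f ∈ B, a ⊓ f = 1) : PrimeSubgroup H :=
  -- One estimate yields all closure conditions: if $f$ and $g$ witness $x$ and $y$, then $f\wedge
  -- g$ witnesses every $z$ bounded by $|x||y||x|$.
  have key : ∀ x y z : H, (∃ f ∈ B, |x|ₘ ⊓ f = 1) → (∃ f ∈ B, |y|ₘ ⊓ f = 1) →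
      |z|ₘ ≤ |x|ₘ * |y|ₘ * |x|ₘ → ∃ f ∈ B, |z|ₘ ⊓ f = 1 := by
    rintro x y z ⟨f, hf, hxf⟩ ⟨g, hg, hyg⟩ hz
    have hfg : 1 ≤ f ⊓ g := le_inf (h1 f hf) (h1 g hg)
    have hx : (f ⊓ g) ⊓ |x|ₘ = 1 := le_antisymm
      ((inf_le_inf_right _ inf_le_left).trans_eq (by rw [inf_comm, hxf]))
      (le_inf hfg (one_le_mabs x))
    have hy : (f ⊓ g) ⊓ |y|ₘ = 1 := le_antisymm
      ((inf_le_inf_right _ inf_le_right).trans_eq (by rw [inf_comm, hyg]))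
      (le_inf hfg (one_le_mabs y))
    refine ⟨f ⊓ g, hinf hf hg, le_antisymm ?_ (le_inf (one_le_mabs z) hfg)⟩
    rw [inf_comm]
    refine (inf_le_inf_left _ hz).trans_eq ?_
    exact inf_mul_eq_one hfg (one_le_mul (one_le_mabs x) (one_le_mabs y)) (one_le_mabs x)
      (inf_mul_eq_one hfg (one_le_mabs x) (one_le_mabs y) hx hy) hx
  { carrier := {x | ∃ f ∈ B, |x|ₘ ⊓ f = 1}
    mul_mem' := fun {x y} hx hy => key x y _ hx hy <| by
      obtain ⟨-, -, h3, h4⟩ := le_mabs_mul_mabs_mul_mabs x y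
      refine mabs_le_iff_and.2 ⟨?_, ?_⟩
      · exact (mul_le_mul' (le_mabs_self x) (le_mabs_self y)).trans h3
      · rw [mul_inv_rev]
        exact (mul_le_mul' (inv_le_mabs y) (inv_le_mabs x)).trans h4
    one_mem' := hne.imp fun f hf => ⟨hf, by rw [mabs_one]; exact inf_eq_left.2 (h1 f hf)⟩
    inv_mem' := fun {x} hx => by
      change ∃ f ∈ B, |x⁻¹|ₘ ⊓ f = 1
      rwa [mabs_inv]
    supClosed' := fun x hx y hy => key x y _ hx hy <| by
      obtain ⟨h1, h2, -, -⟩ := le_mabs_mul_mabs_mul_mabs x y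
      refine mabs_le_iff_and.2 ⟨?_, ?_⟩
      · exact sup_le ((le_mabs_self x).trans h1) ((le_mabs_self y).trans h2)
      · rw [inv_sup]
        exact inf_le_left.trans ((inv_le_mabs x).trans h1)
    infClosed' := fun x hx y hy => key x y _ hx hy <| by
      obtain ⟨h1, h2, -, -⟩ := le_mabs_mul_mabs_mul_mabs x y
      refine mabs_le_iff_and.2 ⟨?_, ?_⟩
      · exact inf_le_left.trans ((le_mabs_self x).trans h1)
      · rw [inv_inf]
        exact sup_le ((inv_le_mabs x).trans h1) ((inv_le_mabs y).trans h2)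
    ordConnected' := ⟨fun x hx y hy z hz => key x y z hx hy <| by
      obtain ⟨h1, h2, -, -⟩ := le_mabs_mul_mabs_mul_mabs x y
      refine mabs_le_iff_and.2 ⟨hz.2.trans ((le_mabs_self y).trans h2), ?_⟩
      exact (inv_le_inv_iff.2 hz.1).trans ((inv_le_mabs x).trans h1)⟩
    proper' := by
      obtain ⟨b, hb⟩ := hne
      refine (Set.ne_univ_iff_exists_notMem _).2 ⟨b, ?_⟩
      rintro ⟨f, hf, hbf⟩
      rw [mabs_of_one_le (h1 b hb)] at hbf
      exact hB (hbf ▸ hinf hb hf)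
    total' := by
      intro x y
      have hpos : ∀ u : H, 1 ≤ u ⊔ 1 := fun u => le_sup_right
      -- The two parts of $u$ are orthogonal, so they cannot both lie in $B$; one outside $B$
      -- belongs to the subgroup and compares the two cosets.
      have hor : ∀ u : H, u ⊔ 1 ∉ B ∨ u⁻¹ ⊔ 1 ∉ B := fun u => by
        by_contra! h
        exact hB (sup_one_inf_inv_sup_one u ▸ hinf h.1 h.2)
      have hmem : ∀ a : H, 1 ≤ a → a ∉ B → ∃ f ∈ B, |a|ₘ ⊓ f = 1 := fun a ha h => by
        rw [mabs_of_one_le ha]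
        exact hmax a ha h
      rcases hor (x * y⁻¹) with h | h
      · exact Or.inl ⟨_, hmem _ (hpos _) h, by rw [sup_mul]; simp⟩
      · exact Or.inr ⟨_, hmem _ (hpos _) h, by rw [sup_mul]; simp⟩ }

/-- A nonempty set of strictly positive elements which is closed under meets is avoided by some
minimal prime subgroup. -/
theorem exists_isMin_disjoint (B : Set H) (hne : B.Nonempty) (h1 : ∀ b ∈ B, 1 ≤ b)
    (hinf : InfClosed B) (hB : (1 : H) ∉ B) :
    ∃ q : PrimeSubgroup H, IsMin q ∧ (∀ b ∈ B, b ∉ q) ∧ ∀ p : PrimeSubgroup H,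
      (∀ a, 1 ≤ a → a ∉ p → a ∈ B) → q ≤ p := by
  obtain ⟨M, hBM, ⟨hM1, hMinf, hM⟩, hmax⟩ := zorn_subset_nonempty
    {M : Set H | (∀ b ∈ M, 1 ≤ b) ∧ InfClosed M ∧ (1 : H) ∉ M} (by
      intro c hc hchain _
      refine ⟨⋃₀ c, ⟨?_, ?_, ?_⟩, fun s hs => Set.subset_sUnion_of_mem hs⟩
      · rintro b ⟨s, hs, hb⟩
        exact (hc hs).1 b hb
      · rintro a ⟨s, hs, ha⟩ b ⟨t, ht, hb⟩
        rcases hchain.total hs ht with h | h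
        · exact ⟨t, ht, (hc ht).2.1 (h ha) hb⟩
        · exact ⟨s, hs, (hc hs).2.1 ha (h hb)⟩
      · rintro ⟨s, hs, h⟩
        exact (hc hs).2.2 h) B ⟨h1, hinf, hB⟩
  have hMne := hne.mono hBM
  have hcompl : ∀ a, 1 ≤ a → a ∉ M → ∃ f ∈ M, a ⊓ f = 1 := by
    intro a ha haM
    by_contra! h
    obtain ⟨m, hm⟩ := hMne
    have ha1 : a ≠ 1 := fun h' => h m hm (h'.symm ▸ inf_eq_left.2 (hM1 m hm))
    -- If $a$ were orthogonal to no element of $M$, then adjoining $a$ and all $a\wedge f$ would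
    -- keep $M$ meet-closed and free of $\mathrm e$, against maximality.
    refine haM (hmax (y := M ∪ insert a ((fun f => a ⊓ f) '' M)) ⟨?_, ?_, ?_⟩
      Set.subset_union_left (Or.inr (Or.inl rfl)))
    · rintro b (hb | rfl | ⟨f, hf, rfl⟩)
      · exact hM1 b hb
      · exact ha
      · exact le_inf ha (hM1 f hf)
    · rintro b (hb | rfl | ⟨f, hf, rfl⟩) c (hc | rfl | ⟨g, hg, rfl⟩)
      · exact Or.inl (hMinf hb hc)
      · exact Or.inr (Or.inr ⟨b, hb, inf_comm _ _⟩)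
      · exact Or.inr (Or.inr ⟨b ⊓ g, hMinf hb hg, inf_left_comm _ _ _⟩)
      · exact Or.inr (Or.inr ⟨c, hc, rfl⟩)
      · exact Or.inr (Or.inl (inf_idem _))
      · exact Or.inr (Or.inr ⟨g, hg, by rw [← inf_assoc, inf_idem]⟩)
      · exact Or.inr (Or.inr ⟨f ⊓ c, hMinf hf hc, (inf_assoc _ _ _).symm⟩)
      · exact Or.inr (Or.inr ⟨f, hf, by rw [inf_right_comm, inf_idem]⟩)
      · exact Or.inr (Or.inr ⟨f ⊓ g, hMinf hf hg, inf_inf_distrib_left _ _ _⟩)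
    · rintro (h' | h' | ⟨f, hf, h'⟩)
      · exact hM h'
      · exact ha1 h'.symm
      · exact h f hf h'
  have havoid : ∀ b ∈ M, b ∉ ofMaximal M hMne hM1 hMinf hM hcompl := by
    rintro b hb ⟨f, hf, h⟩
    rw [mabs_of_one_le (hM1 b hb)] at h
    exact hM (h ▸ hMinf hb hf)
  -- A prime that avoids $M$ contains whatever is orthogonal to some $f\in M$. A prime below the
  -- constructed one also avoids $M$, so this gives minimality.
  have hle : ∀ p : PrimeSubgroup H, (∀ f ∈ M, f ∉ p) →
      ofMaximal M hMne hM1 hMinf hM hcompl ≤ p := by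
    rintro p hp x ⟨f, hf, h⟩
    have h' : |x|ₘ ⊓ f ∈ p := h ▸ one_mem p
    exact p.mabs_mem_iff.1 (((p.inf_mem_iff (one_le_mabs x) (hM1 f hf)).1 h').resolve_right (hp f hf))
  refine ⟨_, fun q hq => hle q fun f hf h => havoid f hf (hq h), fun b hb => havoid b (hBM hb), ?_⟩
  rintro p hp x ⟨f, hf, h⟩
  by_contra hx
  refine havoid _ (hBM (hp _ (one_le_mabs x) fun h' => hx (p.mabs_mem_iff.1 h'))) ⟨f, hf, ?_⟩
  rwa [mabs_mabs]

/-- In a minimal prime subgroup every element is orthogonal to an element outside. -/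
theorem exists_orthogonal_notMem {p : PrimeSubgroup H} (hp : IsMin p) {x : H} (hx1 : 1 ≤ x)
    (hx : x ∈ p) : ∃ y, 1 ≤ y ∧ y ∉ p ∧ x ⊓ y = 1 := by
  by_contra! h
  obtain ⟨z, hz⟩ := p.exists_notMem
  have hz' : |z|ₘ ∉ p := fun h => hz (p.mabs_mem_iff.1 h)
  -- If $x$ were orthogonal to nothing outside $p$, this set would not contain $\mathrm e$. A prime
  -- $q$ avoiding it lies below $p$, so minimality puts $x$ into $q$, although $q$ avoids
  -- $x\wedge|z|\le x$.
  set B : Set H := {a | 1 ≤ a ∧ a ∉ p} ∪ {b | ∃ a, 1 ≤ a ∧ a ∉ p ∧ b = x ⊓ a} with hB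
  obtain ⟨q, -, hq, hle⟩ := exists_isMin_disjoint B ⟨_, Or.inl ⟨one_le_mabs z, hz'⟩⟩ (by
      rintro b (⟨hb, -⟩ | ⟨a, ha, -, rfl⟩)
      · exact hb
      · exact le_inf hx1 ha) (by
      have hi : ∀ a b : H, 1 ≤ a → 1 ≤ b → a ∉ p → b ∉ p → 1 ≤ a ⊓ b ∧ a ⊓ b ∉ p :=
        fun a b ha hb ha' hb' => ⟨le_inf ha hb, fun h =>
          ((p.inf_mem_iff ha hb).1 h).elim ha' hb'⟩
      rintro b (⟨hb, hb'⟩ | ⟨a, ha, ha', rfl⟩) c (⟨hc, hc'⟩ | ⟨d, hd, hd', rfl⟩)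
      · exact Or.inl (hi _ _ hb hc hb' hc')
      · exact Or.inr ⟨b ⊓ d, (hi _ _ hb hd hb' hd').1, (hi _ _ hb hd hb' hd').2,
          inf_left_comm _ _ _⟩
      · exact Or.inr ⟨a ⊓ c, (hi _ _ ha hc ha' hc').1, (hi _ _ ha hc ha' hc').2,
          inf_assoc _ _ _⟩
      · exact Or.inr ⟨a ⊓ d, (hi _ _ ha hd ha' hd').1, (hi _ _ ha hd ha' hd').2,
          (inf_inf_distrib_left _ _ _).symm⟩) (by
      rintro (⟨-, h'⟩ | ⟨a, ha, ha', h'⟩)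
      · exact h' (one_mem p)
      · exact h a ha ha' h'.symm)
  have hxq : x ∈ q := hp (hle p fun a ha ha' => Or.inl ⟨ha, ha'⟩) hx
  exact hq (x ⊓ |z|ₘ) (Or.inr ⟨_, one_le_mabs z, hz', rfl⟩)
    (q.mem_of_le (le_inf hx1 (one_le_mabs z)) inf_le_left hxq)

/-- The minimal prime subgroups intersect in the identity. -/
theorem eq_one_of_forall_isMin {x : H} (h : ∀ p : PrimeSubgroup H, IsMin p → x ∈ p) : x = 1 := by
  by_contra hx
  have hx' : |x|ₘ ≠ 1 := fun h' => hx (le_antisymm (h' ▸ le_mabs_self x)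
    (inv_le_one'.1 (h' ▸ inv_le_mabs x)))
  obtain ⟨q, hq, hq', -⟩ := exists_isMin_disjoint {|x|ₘ} (Set.singleton_nonempty _)
    (by rintro _ rfl; exact one_le_mabs x) (by rintro _ rfl _ rfl; exact inf_idem _)
    (fun h => hx' h.symm)
  exact hq' _ rfl (q.mabs_mem_iff.2 (h q hq))

theorem isOpen_support (A : Set H) : IsOpen (support A) := ⟨A, rfl⟩

end PrimeSubgroup

/-! ### Compactness of the minimal spectrum -/

open PrimeSubgroup

theorem IsWeakUnit.notMem {w : H} (hw : IsWeakUnit w) {p : PrimeSubgroup H} (hp : IsMin p) :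
    w ∉ p := by
  intro h
  obtain ⟨y, hy, hyp, h'⟩ := exists_orthogonal_notMem hp hw.1 h
  rw [← mabs_of_one_le hy] at h'
  exact hyp (hw.2 y h' ▸ one_mem p)

/-- The minimal spectrum is compact if the positive cone is complemented. -/
theorem PositiveConeComplemented.isCompact_minimalSpectrum (hH : PositiveConeComplemented H) :
    IsCompact (minimalSpectrum H) := by
  rw [isCompact_iff_ultrafilter_le_nhds]
  intro f hf
  have hf' : minimalSpectrum H ∈ f := Filter.le_principal_iff.1 hf
  -- A complement of $\mathrm e$ supplies a weak unit. It lies outside every minimal prime, so the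
  -- meet-closed set that defines the limit `q` is nonempty.
  obtain ⟨y, -, -, hw⟩ := hH 1 le_rfl
  obtain ⟨q, hq, hqB, -⟩ := exists_isMin_disjoint {b : H | 1 ≤ b ∧ support {b} ∈ f}
    ⟨1 ⊔ y, hw.1, Filter.mem_of_superset hf' fun p hp => mem_support_singleton.2 (hw.notMem hp)⟩
    (fun b hb => hb.1)
    (fun a ha b hb => ⟨le_inf ha.1 hb.1, Filter.mem_of_superset (Filter.inter_mem ha.2 hb.2)
      fun p hp => by
        simp only [Set.mem_inter_iff, mem_support_singleton] at hp ⊢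
        rw [p.inf_mem_iff ha.1 hb.1]
        exact not_or.2 hp⟩)
    (fun h => by
      obtain ⟨p, hp⟩ := f.nonempty_of_mem h.2
      exact mem_support_singleton.1 hp (one_mem p))
  refine ⟨q, hq, fun U hU => ?_⟩
  obtain ⟨_, hVU, ⟨A, rfl⟩, hqA⟩ := mem_nhds_iff.1 hU
  obtain ⟨a, ha, haq⟩ := Set.not_subset.1 hqA
  have haq' : |a|ₘ ∉ q := fun h => haq (q.mabs_mem_iff.1 h)
  suffices h : support {a} ∈ f from Filter.mem_of_superset h fun p hp =>
    hVU fun hA => mem_support_singleton.1 hp (hA ha)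
  by_contra hn
  obtain ⟨y, hy, hay, hw⟩ := hH |a|ₘ (one_le_mabs a)
  -- Almost every minimal prime contains $|a|$ but not the weak unit $|a|\vee y$, hence misses $y$.
  -- So `q` avoids $y$, while $|a|\wedge y=\mathrm e$ forces $|a|$ or $y$ into `q`.
  have hyf : support {y} ∈ f := by
    filter_upwards [hf', Ultrafilter.compl_mem_iff_notMem.2 hn] with p hp hpa
    refine mem_support_singleton.2 fun hyp => hw.notMem hp (p.supClosed' ?_ hyp)
    exact p.mabs_mem_iff.2 (by_contra fun h => hpa (mem_support_singleton.2 h))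
  rcases (q.inf_mem_iff (one_le_mabs a) hy).1 (hay ▸ one_mem q) with h | h
  · exact haq' h
  · exact hqB y ⟨hy, hyf⟩ h

/-- The positive cone is complemented if the minimal spectrum is compact. -/
theorem positiveConeComplemented_of_isCompact (hc : IsCompact (minimalSpectrum H)) :
    PositiveConeComplemented H := by
  intro x hx
  have : Nonempty {y : H // 1 ≤ y ∧ x ⊓ y = 1} := ⟨⟨1, le_rfl, inf_eq_right.2 hx⟩⟩
  -- Each minimal prime misses $x$ or some $y$ orthogonal to $x$. The cover is directed since joins
  -- of such $y$ stay orthogonal to $x$; hence a single $y$ suffices.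
  obtain ⟨⟨y, hy, hxy⟩, hcov⟩ := hc.elim_directed_cover
    (fun y : {y : H // 1 ≤ y ∧ x ⊓ y = 1} => support {x} ∪ support {y.1})
    (fun y => (isOpen_support _).union (isOpen_support _))
    (fun p hp => by
      by_cases hxp : x ∈ p
      · obtain ⟨y, hy, hyp, hxy⟩ := exists_orthogonal_notMem hp hx hxp
        exact Set.mem_iUnion.2 ⟨⟨y, hy, hxy⟩, Or.inr (mem_support_singleton.2 hyp)⟩
      · exact Set.mem_iUnion.2 ⟨⟨1, le_rfl, inf_eq_right.2 hx⟩,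
          Or.inl (mem_support_singleton.2 hxp)⟩)
    (fun ⟨y, hy, hxy⟩ ⟨z, hz, hxz⟩ => by
      refine ⟨⟨y ⊔ z, hy.trans le_sup_left, inf_sup_eq_one hx hy hz hxy hxz⟩, ?_, ?_⟩
      · exact Set.union_subset_union_right _ fun p hp => mem_support_singleton.2 fun h =>
          mem_support_singleton.1 hp (p.mem_of_le hy le_sup_left h)
      · exact Set.union_subset_union_right _ fun p hp => mem_support_singleton.2 fun h =>
          mem_support_singleton.1 hp (p.mem_of_le hz le_sup_right h))
  refine ⟨y, hy, hxy, hx.trans le_sup_left, fun z hz => eq_one_of_forall_isMin fun p hp => ?_⟩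
  rcases (p.inf_mem_iff (hx.trans le_sup_left) (one_le_mabs z)).1 (hz ▸ one_mem p) with h | h
  · rcases hcov hp with h' | h'
    · exact (mem_support_singleton.1 h' (p.mem_of_le hx le_sup_left h)).elim
    · exact (mem_support_singleton.1 h' (p.mem_of_le hy le_sup_right h)).elim
  · exact p.mabs_mem_iff.1 h

theorem isCompact_minimalSpectrum_iff :
    IsCompact (minimalSpectrum H) ↔ PositiveConeComplemented H :=
  ⟨positiveConeComplemented_of_isCompact, PositiveConeComplemented.isCompact_minimalSpectrum⟩

/-! ### Principal polars -/

theorem perp_singleton_mabs (x : H) : perp {|x|ₘ} = perp {x} := by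
  ext z
  rw [mem_perp_singleton, mem_perp_singleton, mabs_mabs]

theorem perp_singleton_sup {x y : H} (hx : 1 ≤ x) (hy : 1 ≤ y) :
    perp {x ⊔ y} = perp {x} ∩ perp {y} := by
  ext z
  have hz := one_le_mabs z
  rw [Set.mem_inter_iff, mem_perp_singleton, mem_perp_singleton, mem_perp_singleton,
    mabs_of_one_le hx, mabs_of_one_le hy, mabs_of_one_le (hx.trans le_sup_left)]
  refine ⟨fun h => ⟨?_, ?_⟩, fun h => inf_sup_eq_one hz hx hy h.1 h.2⟩
  · exact le_antisymm ((inf_le_inf_left _ le_sup_left).trans_eq h) (le_inf hz hx)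
  · exact le_antisymm ((inf_le_inf_left _ le_sup_right).trans_eq h) (le_inf hz hy)

theorem coe_compl_principalPolar (x : H) : (principalPolar x)ᶜ.1 = perp {x} :=
  perp_perp_perp {x}

/-- Complements of principal polars are single polars, where joins become intersections:
$(|x|\vee|y|)^\perp=x^\perp\cap y^\perp$. -/
theorem principalPolar_compl_inf (x y : H) :
    (principalPolar x)ᶜ ⊓ (principalPolar y)ᶜ = (principalPolar (|x|ₘ ⊔ |y|ₘ))ᶜ := by
  refine Subtype.ext ?_
  change (principalPolar x)ᶜ.1 ∩ (principalPolar y)ᶜ.1 = _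
  rw [coe_compl_principalPolar, coe_compl_principalPolar, coe_compl_principalPolar,
    perp_singleton_sup (one_le_mabs x) (one_le_mabs y), perp_singleton_mabs, perp_singleton_mabs]

theorem principalPolar_sup (x y : H) :
    principalPolar x ⊔ principalPolar y = principalPolar (|x|ₘ ⊔ |y|ₘ) := by
  rw [← compl_inj_iff, compl_sup, principalPolar_compl_inf]

theorem principalPolar_one : principalPolar (1 : H) = ⊥ := by
  rw [← compl_inj_iff, compl_bot]
  refine Subtype.ext ?_
  rw [coe_compl_principalPolar]
  refine Set.eq_univ_of_forall fun z => mem_perp_singleton.2 ?_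
  rw [mabs_one]
  exact inf_eq_right.2 (one_le_mabs z)

theorem isWeakUnit_iff {w : H} (hw : 1 ≤ w) : IsWeakUnit w ↔ principalPolar w = ⊤ := by
  rw [← compl_inj_iff, compl_top]
  refine ⟨fun h => Subtype.ext ?_, fun h => ⟨hw, fun x hx => ?_⟩⟩
  · rw [coe_compl_principalPolar]
    refine Set.Subset.antisymm (fun z hz => h.2 z ?_)
      (Set.singleton_subset_iff.2 (Polar.one_mem_perp _))
    rwa [mem_perp_singleton, mabs_of_one_le hw, inf_comm] at hz
  · have h' := congrArg Subtype.val h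
    rw [coe_compl_principalPolar] at h'
    have : x ∈ perp {w} := mem_perp_singleton.2 (by rwa [mabs_of_one_le hw, inf_comm])
    rw [h'] at this
    exact this

theorem disjoint_principalPolar_iff {x y : H} (hx : 1 ≤ x) (hy : 1 ≤ y) :
    Disjoint (principalPolar x) (principalPolar y) ↔ x ⊓ y = 1 := by
  rw [← le_compl_iff_disjoint_right]
  change perp (perp {x}) ⊆ (principalPolar y)ᶜ.1 ↔ _
  rw [coe_compl_principalPolar]
  have hxy : x ∈ perp {y} ↔ x ⊓ y = 1 := by
    rw [mem_perp_singleton, mabs_of_one_le hx, mabs_of_one_le hy]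
  rw [← hxy]
  refine ⟨fun h => h (subset_perp_perp {x} rfl), fun h => ?_⟩
  exact (perp_anti (perp_anti (Set.singleton_subset_iff.2 h))).trans (perp_perp_perp {y}).subset

theorem principalPolar_mabs (x : H) : principalPolar |x|ₘ = principalPolar x :=
  Subtype.ext (congrArg perp (perp_singleton_mabs x))

/-- Orthogonality says that the two principal polars are disjoint, and the weak unit says that their
join is everything. -/
theorem principalPolar_compl_eq_iff {x y : H} (hx : 1 ≤ x) (hy : 1 ≤ y) :
    (principalPolar x)ᶜ = principalPolar y ↔ x ⊓ y = 1 ∧ IsWeakUnit (x ⊔ y) := by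
  rw [isWeakUnit_iff (hx.trans le_sup_left), ← disjoint_principalPolar_iff hx hy]
  have := principalPolar_sup x y
  rw [mabs_of_one_le hx, mabs_of_one_le hy] at this
  rw [← this, ← codisjoint_iff, ← isCompl_iff]
  exact ⟨fun h => h ▸ isCompl_compl, fun h => h.compl_eq⟩

theorem principalPolarsBoolean_iff : PrincipalPolarsBoolean H ↔ PositiveConeComplemented H := by
  constructor
  · rintro ⟨B, hB⟩ x hx
    have hxB : principalPolar x ∈ (B : Set (Polar H)) := hB ▸ ⟨x, rfl⟩
    have hxB' : (principalPolar x)ᶜ ∈ (B : Set (Polar H)) := B.compl_mem' hxB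
    rw [hB] at hxB'
    obtain ⟨y, hy⟩ := hxB'
    refine ⟨|y|ₘ, one_le_mabs y, (principalPolar_compl_eq_iff hx (one_le_mabs y)).1 ?_⟩
    rw [principalPolar_mabs, hy]
  · intro h
    have hcompl : ∀ T ∈ principalPolars H, Tᶜ ∈ principalPolars H := by
      rintro _ ⟨x, rfl⟩
      obtain ⟨y, hy, hxy⟩ := h |x|ₘ (one_le_mabs x)
      refine ⟨y, ?_⟩
      rw [← (principalPolar_compl_eq_iff (one_le_mabs x) hy).2 hxy, principalPolar_mabs]
    have hsup : SupClosed (principalPolars H) := by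
      rintro _ ⟨x, rfl⟩ _ ⟨y, rfl⟩
      exact ⟨_, (principalPolar_sup x y).symm⟩
    refine ⟨⟨⟨principalPolars H, hsup, fun S hS T hT => ?_⟩, fun {T} hT => hcompl T hT,
      ⟨1, principalPolar_one⟩⟩, rfl⟩
    -- Meets come from joins and complements by De Morgan.
    have := hcompl _ (hsup (hcompl S hS) (hcompl T hT))
    rwa [compl_sup, compl_compl, compl_compl] at this

end LGroup


/-! ### Generated ℓ-subgroups and values of terms -/

namespace LSubgroup

variable {H : Type u} [Group H] [Lattice H] (K : LSubgroup H)

instance [MulLeftMono H] : MulLeftMono K :=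
  ⟨fun a b c (h : b.1 ≤ c.1) => (mul_le_mul_right h a.1 : a.1 * b.1 ≤ a.1 * c.1)⟩

instance [MulRightMono H] : MulRightMono K :=
  ⟨fun a b c (h : b.1 ≤ c.1) => (mul_le_mul_left h a.1 : b.1 * a.1 ≤ c.1 * a.1)⟩

theorem subset_closure (S : Set H) : S ⊆ closure S := fun _ hx _ hK => hK hx

/-- The ℓ-subgroup of the values of terms. -/
def evalRange {X : Type v} (f : X → H) : LSubgroup H where
  carrier := Set.range (LTerm.eval f)
  mul_mem' := by rintro _ _ ⟨s, rfl⟩ ⟨t, rfl⟩; exact ⟨.mul s t, rfl⟩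
  one_mem' := ⟨.one, rfl⟩
  inv_mem' := by rintro _ ⟨s, rfl⟩; exact ⟨.inv s, rfl⟩
  supClosed' := by rintro _ ⟨s, rfl⟩ _ ⟨t, rfl⟩; exact ⟨.sup s t, rfl⟩
  infClosed' := by rintro _ ⟨s, rfl⟩ _ ⟨t, rfl⟩; exact ⟨.inf s t, rfl⟩

/-- Values of terms already form an ℓ-subgroup. This reduces identities in $H_C$ to identities
between terms over $G$. -/
theorem exists_eval_of_mem_closure {X : Type v} {f : X → H} {x : H}
    (hx : x ∈ closure (Set.range f)) : ∃ t : LTerm X, t.eval f = x :=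
  hx (evalRange f) (by rintro _ ⟨a, rfl⟩; exact ⟨.var a, rfl⟩)

theorem coe_eval {X : Type v} (f : X → K) (t : LTerm X) :
    ((t.eval f : K) : H) = t.eval fun x => (f x : H) := by
  induction t with
  | var x => rfl
  | one => rfl
  | mul s t hs ht => rw [LTerm.eval, LTerm.eval, ← hs, ← ht]; rfl
  | inv s hs => rw [LTerm.eval, LTerm.eval, ← hs]; rfl
  | sup s t hs ht => rw [LTerm.eval, LTerm.eval, ← hs, ← ht]; rfl
  | inf s t hs ht => rw [LTerm.eval, LTerm.eval, ← hs, ← ht]; rfl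

end LSubgroup

/-! ### Pointwise rules for automorphisms of a chain -/

namespace ChainAut

variable {Ω : Type u} [LinearOrder Ω]

theorem mul_apply (f g : ChainAut Ω) (x : Ω) : (f * g) x = g (f x) := rfl

theorem one_apply (x : Ω) : (1 : ChainAut Ω) x = x := rfl

theorem sup_apply (f g : ChainAut Ω) (x : Ω) : (f ⊔ g) x = f x ⊔ g x := rfl

theorem inf_apply (f g : ChainAut Ω) (x : Ω) : (f ⊓ g) x = f x ⊓ g x := rfl

theorem apply_inv_apply (f : ChainAut Ω) (x : Ω) : f (f⁻¹ x) = x := by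
  rw [← mul_apply, inv_mul_cancel, one_apply]

theorem inv_apply_apply (f : ChainAut Ω) (x : Ω) : f⁻¹ (f x) = x := by
  rw [← mul_apply, mul_inv_cancel, one_apply]

theorem inv_apply_eq_iff (f : ChainAut Ω) (x y : Ω) : f⁻¹ x = y ↔ f y = x :=
  ⟨fun h => h ▸ apply_inv_apply f x, fun h => h ▸ inv_apply_apply f y⟩

theorem monotone (f : ChainAut Ω) : Monotone f := OrderIso.monotone f

@[ext] theorem ext {f g : ChainAut Ω} (h : ∀ x, f x = g x) : f = g := DFunLike.ext _ _ h

end ChainAut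

/-! ### The right pre-order of a prime subgroup -/

namespace PrimeSubgroup

variable {H : Type u} [Group H] [Lattice H]

/-- The total right pre-order `p x ≤ p y` on an ℓ-group. -/
def Le (p : PrimeSubgroup H) (x y : H) : Prop := ∃ t ∈ p, x ≤ t * y

variable (p : PrimeSubgroup H) {x y z : H}

theorem le_total (x y : H) : p.Le x y ∨ p.Le y x := p.total' x y

theorem Le.of_le (h : x ≤ y) : p.Le x y := ⟨1, one_mem p, by rwa [one_mul]⟩

variable {p}

theorem sup_one_mem {t : H} (ht : t ∈ p) : t ⊔ 1 ∈ p := p.supClosed' ht (one_mem p)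

theorem Le.mul_right [MulRightMono H] (h : p.Le x y) (z : H) : p.Le (x * z) (y * z) := by
  obtain ⟨t, ht, hxy⟩ := h
  refine ⟨t, ht, ?_⟩
  rw [← mul_assoc]
  exact mul_le_mul_left hxy z

theorem mul_right_le_iff [MulRightMono H] (z : H) : p.Le (x * z) (y * z) ↔ p.Le x y :=
  ⟨fun h => by simpa using h.mul_right z⁻¹, fun h => h.mul_right z⟩

/-- Together with `Le.le_inf`, this makes joins and meets of elements act as maxima and minima of
cosets. Enlarging the witness $t$ to $t\vee\mathrm e$ lets it bound both arguments. -/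
theorem Le.sup_le [MulRightMono H] (h : p.Le x y) : p.Le (x ⊔ y) y := by
  obtain ⟨t, ht, hxy⟩ := h
  refine ⟨t ⊔ 1, sup_one_mem ht, ?_⟩
  rw [sup_mul, one_mul]
  exact sup_le_sup_right hxy y

variable [MulLeftMono H]

theorem Le.trans (h : p.Le x y) (h' : p.Le y z) : p.Le x z := by
  obtain ⟨t, ht, hxy⟩ := h
  obtain ⟨s, hs, hyz⟩ := h'
  refine ⟨t * s, mul_mem ht hs, hxy.trans ?_⟩
  rw [mul_assoc]
  exact mul_le_mul_right hyz t

theorem mem_iff_le : x ∈ p ↔ p.Le x 1 ∧ p.Le 1 x := by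
  constructor
  · exact fun h => ⟨⟨x, h, by rw [mul_one]⟩, ⟨x⁻¹, inv_mem h, by rw [inv_mul_cancel]⟩⟩
  · rintro ⟨⟨t, ht, h⟩, ⟨s, hs, h'⟩⟩
    rw [mul_one] at h
    refine p.ordConnected'.out (inv_mem hs) ht ⟨?_, h⟩
    exact inv_le_iff_one_le_mul'.2 h'

variable [MulRightMono H]

theorem Le.le_inf (h : p.Le x y) : p.Le x (x ⊓ y) := by
  obtain ⟨t, ht, hxy⟩ := h
  refine ⟨t ⊔ 1, sup_one_mem ht, ?_⟩
  rw [mul_inf, sup_mul, sup_mul, one_mul, one_mul]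
  exact _root_.le_inf le_sup_right (hxy.trans le_sup_left)

theorem one_le_iff : p.Le 1 x ↔ x ⊓ 1 ∈ p := by
  rw [mem_iff_le]
  refine ⟨fun h => ⟨Le.of_le p inf_le_right, ?_⟩, fun h => h.2.trans (Le.of_le p inf_le_left)⟩
  rw [inf_comm]
  exact h.le_inf

theorem le_one_iff : p.Le x 1 ↔ x ⊔ 1 ∈ p := by
  rw [mem_iff_le]
  exact ⟨fun h => ⟨h.sup_le, Le.of_le p le_sup_right⟩, fun h => (Le.of_le p le_sup_left).trans h.1⟩

/-- Inclusion is recovered from the topology, so every homeomorphism onto the spectrum determines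
the minimal primes. -/
theorem le_iff_specializes {p q : PrimeSubgroup H} : p ≤ q ↔ p ⤳ q := by
  rw [specializes_iff_forall_open]
  constructor
  · rintro h _ ⟨A, rfl⟩ hq hp
    exact hq fun a ha => h (hp ha)
  · intro h a ha
    by_contra hq
    exact mem_support_singleton.1 (h _ (isOpen_support {a}) (mem_support_singleton.2 hq)) ha

end PrimeSubgroup

/-! ### The free ℓ-group and its spectrum -/

section Spectrum

variable {V : LVariety} {G : Type u} [Group G] [PartialOrder G]

local instance : Max (FreeLGroup V G) := SemilatticeSup.toMax

local instance : Min (FreeLGroup V G) := SemilatticeInf.toMin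

namespace FreeLGroup

theorem mk_eq_eval (t : LTerm G) : (mk t : FreeLGroup V G) = t.eval eta := by
  induction t with
  | var x => rfl
  | one => rfl
  | mul s t hs ht => rw [LTerm.eval, ← hs, ← ht]; rfl
  | inv s hs => rw [LTerm.eval, ← hs]; rfl
  | sup s t hs ht => rw [LTerm.eval, ← hs, ← ht]; rfl
  | inf s t hs ht => rw [LTerm.eval, ← hs, ← ht]; rfl

/-- The sublattice generated by the image of `G` is everything. -/
theorem mem_latticeClosure (x : FreeLGroup V G) :
    x ∈ latticeClosure (Set.range (eta : G →* FreeLGroup V G)) := by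
  set L := latticeClosure (Set.range (eta : G →* FreeLGroup V G)) with hL
  have hsup : ∀ {x y}, x ∈ L → y ∈ L → x ⊔ y ∈ L := fun hx hy =>
    isSublattice_latticeClosure.supClosed hx hy
  have hinf : ∀ {x y}, x ∈ L → y ∈ L → x ⊓ y ∈ L := fun hx hy =>
    isSublattice_latticeClosure.infClosed hx hy
  have heta : ∀ a : G, eta a ∈ L := fun a => subset_latticeClosure ⟨a, rfl⟩
  -- Multiplication distributes over both lattice operations and inversion exchanges them, so the
  -- generated sublattice is closed under the group operations.
  have hmul' : ∀ a : G, ∀ y ∈ L, eta a * y ∈ L := by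
    intro a y hy
    induction hy using latticeClosure_sup_inf_induction with
    | mem _ h => obtain ⟨b, rfl⟩ := h; rw [← map_mul]; exact heta _
    | sup x _ y _ hx hy => rw [mul_sup]; exact hsup hx hy
    | inf x _ y _ hx hy => rw [mul_inf]; exact hinf hx hy
  have hmul : ∀ x ∈ L, ∀ y ∈ L, x * y ∈ L := by
    intro x hx z hz
    induction hx using latticeClosure_sup_inf_induction with
    | mem _ h => obtain ⟨b, rfl⟩ := h; exact hmul' b z hz
    | sup x _ y _ hx hy => rw [sup_mul]; exact hsup hx hy
    | inf x _ y _ hx hy => rw [inf_mul]; exact hinf hx hy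
  have hinv : ∀ x ∈ L, x⁻¹ ∈ L := by
    intro x hx
    induction hx using latticeClosure_sup_inf_induction with
    | mem _ h => obtain ⟨b, rfl⟩ := h; rw [← map_inv]; exact heta _
    | sup x _ y _ hx hy => rw [inv_sup]; exact hinf hx hy
    | inf x _ y _ hx hy => rw [inv_inf]; exact hsup hx hy
  obtain ⟨t, rfl⟩ := mk_surjective x
  rw [mk_eq_eval]
  induction t with
  | var a => exact heta a
  | one => rw [LTerm.eval, ← map_one eta]; exact heta 1
  | mul s t hs ht => exact hmul _ hs _ ht
  | inv s hs => exact hinv _ hs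
  | sup s t hs ht => exact hsup hs ht
  | inf s t hs ht => exact hinf hs ht

theorem mem_of_forall_eta_mem {K : LSubgroup (FreeLGroup V G)} (h : ∀ a : G, eta a ∈ K)
    (x : FreeLGroup V G) : x ∈ K :=
  latticeClosure_min (t := (K : Set (FreeLGroup V G))) (by rintro _ ⟨a, rfl⟩; exact h a)
    ⟨fun _ hx _ hy => K.supClosed' hx hy, fun _ hx _ hy => K.infClosed' hx hy⟩
    (mem_latticeClosure x)

end FreeLGroup

open FreeLGroup

/-! ### From prime subgroups to right pre-orders -/

namespace PrimeSubgroup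

/-- The pre-cone `{a ∈ G | p ≤ p η(a)}`. -/
def toPreCone (p : PrimeSubgroup (FreeLGroup V G)) : PreCone G where
  carrier := {a | p.Le 1 (eta a)}
  mul_mem' {a b} ha hb := by
    change p.Le 1 (eta (a * b))
    rw [map_mul]
    exact Le.trans hb (by simpa using Le.mul_right ha (eta b))
  one_mem' := Le.of_le p (map_one _).ge
  total' a := by
    refine (p.le_total 1 (eta a)).imp_right fun h => ?_
    simpa using h.mul_right (eta a⁻¹)
  pos' a ha := Le.of_le p ((map_one eta).symm.trans_le (eta_monotone ha))
  proper' h := by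
    have h' : ∀ a : G, p.Le 1 (eta a) := fun a => (h.symm ▸ Set.mem_univ a : a ∈ {a | p.Le 1 (eta a)})
    obtain ⟨x, hx⟩ := p.exists_notMem
    -- If all of $G$ were in the pre-cone, applying this to $a$ and $a^{-1}$ would put every
    -- $\eta(a)$, hence all of $H$, into `p`.
    refine hx (mem_of_forall_eta_mem (K := p.toLSubgroup) (fun a => mem_iff_le.2 ⟨?_, h' a⟩) x)
    simpa using (h' a⁻¹).mul_right (eta a)

variable (p : PrimeSubgroup (FreeLGroup V G))

theorem mem_toPreCone {a : G} : a ∈ p.toPreCone ↔ p.Le 1 (eta a) := Iff.rfl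

/-- $[a]\mapsto\mathfrak p\,\eta(a)$ embeds the chain $\Omega_C$ into the chain of right cosets. -/
theorem toPreCone_le_iff {a b : G} :
    p.toPreCone.cls a ≤ p.toPreCone.cls b ↔ p.Le (eta a) (eta b) := by
  rw [PreCone.cls_le_cls, PreCone.Le, mem_toPreCone, ← mul_right_le_iff (eta a), ← map_mul]
  simp

theorem toPreCone_cls_eq_iff {a b : G} : p.toPreCone.cls a = p.toPreCone.cls b ↔
    p.Le (eta a) (eta b) ∧ p.Le (eta b) (eta a) := by
  rw [le_antisymm_iff, toPreCone_le_iff, toPreCone_le_iff]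

/-- The action of a term on `Ω_C` describes its action on the right cosets of `p`. -/
theorem le_of_eval_rho_apply (s : LTerm G) {b c : G}
    (h : s.eval p.toPreCone.rho (p.toPreCone.cls b) = p.toPreCone.cls c) :
    p.Le (eta b * s.eval eta) (eta c) ∧ p.Le (eta c) (eta b * s.eval eta) := by
  have hcls : ∀ ω : p.toPreCone.Omega, ∃ d, p.toPreCone.cls d = ω := Quotient.exists_rep
  induction s generalizing b c with
  | var a =>
    rw [LTerm.eval, PreCone.rho_apply, toPreCone_cls_eq_iff, map_mul] at h
    exact h
  | one =>
    rw [LTerm.eval, ChainAut.one_apply, toPreCone_cls_eq_iff] at h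
    rwa [LTerm.eval, mul_one]
  | mul s t hs ht =>
    rw [LTerm.eval, ChainAut.mul_apply] at h
    obtain ⟨d, hd⟩ := hcls (s.eval p.toPreCone.rho (p.toPreCone.cls b))
    obtain ⟨h1, h2⟩ := hs hd.symm
    rw [← hd] at h
    obtain ⟨h3, h4⟩ := ht h
    rw [LTerm.eval, ← mul_assoc]
    exact ⟨(h1.mul_right _).trans h3, h4.trans (h2.mul_right _)⟩
  | inv s hs =>
    rw [LTerm.eval, ChainAut.inv_apply_eq_iff] at h
    obtain ⟨h1, h2⟩ := hs h
    exact ⟨by simpa [LTerm.eval] using h2.mul_right (s.eval eta)⁻¹,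
      by simpa [LTerm.eval] using h1.mul_right (s.eval eta)⁻¹⟩
  | sup s t hs ht =>
    rw [LTerm.eval, ChainAut.sup_apply] at h
    obtain ⟨d, hd⟩ := hcls (s.eval p.toPreCone.rho (p.toPreCone.cls b))
    obtain ⟨e, he⟩ := hcls (t.eval p.toPreCone.rho (p.toPreCone.cls b))
    obtain ⟨h1, h2⟩ := hs hd.symm
    obtain ⟨h3, h4⟩ := ht he.symm
    rw [← hd, ← he] at h
    rw [LTerm.eval, mul_sup]
    -- In a chain the join is the larger of the two classes, and the coset of the join is likewise
    -- the larger coset.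
    rcases _root_.le_total (p.toPreCone.cls d) (p.toPreCone.cls e) with hde | hde
    · rw [sup_eq_right.2 hde, toPreCone_cls_eq_iff] at h
      rw [toPreCone_le_iff] at hde
      exact ⟨(h1.trans (hde.trans h4)).sup_le.trans (h3.trans h.1),
        h.2.trans (h4.trans (Le.of_le p le_sup_right))⟩
    · rw [sup_eq_left.2 hde, toPreCone_cls_eq_iff] at h
      rw [toPreCone_le_iff] at hde
      rw [sup_comm]
      exact ⟨(h3.trans (hde.trans h2)).sup_le.trans (h1.trans h.1),
        h.2.trans (h2.trans (Le.of_le p le_sup_right))⟩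
  | inf s t hs ht =>
    rw [LTerm.eval, ChainAut.inf_apply] at h
    obtain ⟨d, hd⟩ := hcls (s.eval p.toPreCone.rho (p.toPreCone.cls b))
    obtain ⟨e, he⟩ := hcls (t.eval p.toPreCone.rho (p.toPreCone.cls b))
    obtain ⟨h1, h2⟩ := hs hd.symm
    obtain ⟨h3, h4⟩ := ht he.symm
    rw [← hd, ← he] at h
    rw [LTerm.eval, mul_inf]
    rcases _root_.le_total (p.toPreCone.cls d) (p.toPreCone.cls e) with hde | hde
    · rw [inf_eq_left.2 hde, toPreCone_cls_eq_iff] at h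
      rw [toPreCone_le_iff] at hde
      exact ⟨(Le.of_le p inf_le_left).trans (h1.trans h.1),
        h.2.trans (h2.trans (h1.trans (hde.trans h4)).le_inf)⟩
    · rw [inf_eq_right.2 hde, toPreCone_cls_eq_iff] at h
      rw [toPreCone_le_iff] at hde
      rw [inf_comm]
      exact ⟨(Le.of_le p inf_le_left).trans (h3.trans h.1),
        h.2.trans (h4.trans (h3.trans (hde.trans h2)).le_inf)⟩

/-- The class to which a term moves $[b]$ is determined by the coset of $\eta(b)$ times its value in
$H$. Thus identities of $H$ pass to $H_C$. -/
theorem eval_rho_eq_of_eval_eta_eq {s t : LTerm G}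
    (h : s.eval (eta : G →* FreeLGroup V G) = t.eval eta) :
    s.eval p.toPreCone.rho = t.eval p.toPreCone.rho := by
  ext ω
  obtain ⟨b, rfl⟩ : ∃ b, p.toPreCone.cls b = ω := Quotient.exists_rep ω
  obtain ⟨c, hc⟩ : ∃ c, p.toPreCone.cls c = s.eval p.toPreCone.rho (p.toPreCone.cls b) :=
    Quotient.exists_rep _
  obtain ⟨d, hd⟩ : ∃ d, p.toPreCone.cls d = t.eval p.toPreCone.rho (p.toPreCone.cls b) :=
    Quotient.exists_rep _
  obtain ⟨h1, h2⟩ := p.le_of_eval_rho_apply s hc.symm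
  obtain ⟨h3, h4⟩ := p.le_of_eval_rho_apply t hd.symm
  rw [h] at h1 h2
  rw [← hc, ← hd, toPreCone_cls_eq_iff]
  exact ⟨h2.trans h3, h4.trans h1⟩

theorem toPreCone_mem_variety : V.Mem p.toPreCone.H := by
  intro e he f
  choose t ht using fun n => LSubgroup.exists_eval_of_mem_closure (f n).2
  refine Subtype.ext ?_
  rw [LSubgroup.coe_eval, LSubgroup.coe_eval, ← funext ht, ← LTerm.eval_subst,
    ← LTerm.eval_subst]
  apply p.eval_rho_eq_of_eval_eta_eq
  rw [LTerm.eval_subst, LTerm.eval_subst]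
  exact mem_variety V G e he _

/-- The right pre-order of the variety which is defined by a prime subgroup. -/
def toVPreorder : VPreorders V G := ⟨p.toPreCone, p.toPreCone_mem_variety⟩

end PrimeSubgroup

/-! ### From right pre-orders to prime subgroups -/

namespace VPreorders

/-- By totality, $\mathbb P(a)$ is just the condition $a^{-1}\notin C$, which passes to smaller
pre-cones. -/
theorem le_iff_specializes {C D : VPreorders V G} : C ≤ D ↔ C ⤳ D := by
  constructor
  · intro h
    rw [Specializes, TopologicalSpace.nhds_generateFrom, TopologicalSpace.nhds_generateFrom]
    refine le_iInf₂ fun s hs => iInf₂_le s ⟨?_, hs.2⟩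
    obtain ⟨hDs, a, rfl⟩ := hs
    have ha : a⁻¹ ∉ C.1 := fun h' => hDs.2 (h h')
    exact ⟨(C.1.total' a).resolve_right ha, ha⟩
  · intro h a ha
    by_contra hD
    have hD' : a⁻¹ ∈ D.1 := (D.1.total' a).resolve_left hD
    have := h.mem_open (TopologicalSpace.isOpen_generateFrom_of_mem ⟨a⁻¹, rfl⟩)
      (⟨hD', by rwa [inv_inv]⟩ : D ∈ basicOpen a⁻¹)
    exact this.2 (by rwa [inv_inv])

theorem one_le_cls_iff (C : VPreorders V G) {a : G} : C.1.cls 1 ≤ C.1.cls a ↔ a ∈ C.1 := by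
  rw [PreCone.cls_le_cls, PreCone.Le, inv_one, mul_one]

theorem cls_le_one_iff (C : VPreorders V G) {a : G} : C.1.cls a ≤ C.1.cls 1 ↔ a⁻¹ ∈ C.1 := by
  rw [PreCone.cls_le_cls, PreCone.Le, one_mul]

variable [MulLeftMono G] [MulRightMono G] (C : VPreorders V G)

/-- $[ca]\le[cb]$ asks for $c(ba^{-1})c^{-1}\in C$, and conjugates of positive elements are
positive. -/
theorem rho_monotone : Monotone C.1.rho := by
  rintro a b hab ⟨c⟩
  change C.1.Le (c * a) (c * b)
  refine C.1.pos' _ ?_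
  rw [mul_inv_rev, ← mul_assoc, mul_assoc c b]
  have h : (1 : G) ≤ b * a⁻¹ := by
    simpa using mul_le_mul_left hab a⁻¹
  simpa using mul_le_mul_left (mul_le_mul_right h c) c⁻¹

/-- The universal property is applied to $H_C$, which is in $\mathsf V$ by hypothesis, and not to
$\mathrm{Aut}(\Omega_C)$, which need not be; the inclusion is composed afterwards. -/
theorem exists_act : ∃ φ : FreeLGroup V G →* ChainAut C.1.Omega,
    (∀ x y, φ (x ⊔ y) = φ x ⊔ φ y) ∧ (∀ x y, φ (x ⊓ y) = φ x ⊓ φ y) ∧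
      ∀ a, φ (eta a) = C.1.rho a := by
  obtain ⟨h, ⟨hs, hi, he⟩, -⟩ := existsUnique_lift C.2
    (MonoidHom.mk' (fun a => (⟨C.1.rho a, LSubgroup.subset_closure _ ⟨a, rfl⟩⟩ : C.1.H))
      (fun a b => Subtype.ext (map_mul C.1.rho a b)))
    (fun a b hab => C.rho_monotone hab)
  refine ⟨MonoidHom.mk' (fun x => (h x : ChainAut C.1.Omega)) fun x y => ?_, fun x y => ?_,
    fun x y => ?_, fun a => ?_⟩
  · rw [map_mul]; rfl
  · exact congrArg Subtype.val (hs x y)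
  · exact congrArg Subtype.val (hi x y)
  · exact congrArg Subtype.val (he a)

/-- The action of the free ℓ-group on the chain `Ω_C`. -/
noncomputable def act : FreeLGroup V G →* ChainAut C.1.Omega := C.exists_act.choose

theorem act_sup (x y : FreeLGroup V G) : C.act (x ⊔ y) = C.act x ⊔ C.act y :=
  C.exists_act.choose_spec.1 x y

theorem act_inf (x y : FreeLGroup V G) : C.act (x ⊓ y) = C.act x ⊓ C.act y :=
  C.exists_act.choose_spec.2.1 x y

theorem act_eta (a : G) : C.act (eta a) = C.1.rho a := C.exists_act.choose_spec.2.2 a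

theorem act_monotone : Monotone C.act := fun x y h => by
  rw [← sup_eq_right, ← C.act_sup, sup_eq_right.2 h]

theorem act_eval (t : LTerm G) : C.act (t.eval eta) = t.eval C.1.rho := by
  induction t with
  | var a => exact C.act_eta a
  | one => exact map_one _
  | mul s t hs ht => rw [LTerm.eval, map_mul, hs, ht]; rfl
  | inv s hs => rw [LTerm.eval, map_inv, hs]; rfl
  | sup s t hs ht => rw [LTerm.eval, act_sup, hs, ht]; rfl
  | inf s t hs ht => rw [LTerm.eval, act_inf, hs, ht]; rfl

/-- The image of the base point `[e]` under the action. -/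
noncomputable def orbit (x : FreeLGroup V G) : C.1.Omega := C.act x (C.1.cls 1)

theorem orbit_sup (x y : FreeLGroup V G) : C.orbit (x ⊔ y) = C.orbit x ⊔ C.orbit y := by
  rw [orbit, act_sup]; rfl

theorem orbit_inf (x y : FreeLGroup V G) : C.orbit (x ⊓ y) = C.orbit x ⊓ C.orbit y := by
  rw [orbit, act_inf]; rfl

theorem orbit_eta (a : G) : C.orbit (eta a) = C.1.cls a := by
  rw [orbit, act_eta, PreCone.rho_apply, one_mul]

theorem orbit_one : C.orbit 1 = C.1.cls 1 := by
  rw [orbit, map_one]; rfl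

theorem orbit_monotone : Monotone C.orbit := fun _ _ h => C.act_monotone h _

theorem orbit_mul (x y : FreeLGroup V G) : C.orbit (x * y) = C.act y (C.orbit x) := by
  rw [orbit, map_mul]; rfl

/-- The stabilizer of the base point `[e]` in the free ℓ-group. -/
noncomputable def toPrimeSubgroup : PrimeSubgroup (FreeLGroup V G) where
  carrier := {x | C.orbit x = C.1.cls 1}
  mul_mem' {x y} hx hy := by
    change C.orbit (x * y) = _
    rw [orbit_mul, hx]
    exact hy
  one_mem' := C.orbit_one
  inv_mem' {x} hx := by
    change C.act x⁻¹ _ = _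
    rw [map_inv, ChainAut.inv_apply_eq_iff]
    exact hx
  supClosed' x hx y hy := by
    change C.orbit (x ⊔ y) = _
    rw [orbit_sup, hx, hy, sup_idem]
  infClosed' x hx y hy := by
    change C.orbit (x ⊓ y) = _
    rw [orbit_inf, hx, hy, inf_idem]
  ordConnected' := ⟨fun x hx y hy z hz =>
    le_antisymm ((C.orbit_monotone hz.2).trans_eq hy)
      ((Eq.symm hx).trans_le (C.orbit_monotone hz.1))⟩
  proper' h := by
    obtain ⟨a, ha⟩ := (Set.ne_univ_iff_exists_notMem _).1 C.1.proper'
    have : C.orbit (eta a) = C.1.cls 1 :=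
      (h.symm ▸ Set.mem_univ _ : eta a ∈ {x | C.orbit x = C.1.cls 1})
    rw [orbit_eta] at this
    exact ha (C.one_le_cls_iff.1 this.ge)
  total' := by
    have key : ∀ x y : FreeLGroup V G, C.orbit x ≤ C.orbit y →
        ∃ t ∈ {x | C.orbit x = C.1.cls 1}, x ≤ t * y := by
      intro x y h
      -- When $x$ moves $[\mathrm e]$ no higher than $y$ does, $xy^{-1}$ does not raise $[\mathrm
      -- e]$, so its positive part fixes it.
      refine ⟨x * y⁻¹ ⊔ 1, ?_, by rw [sup_mul]; simp⟩
      change C.orbit _ = _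
      rw [orbit_sup, orbit_mul, orbit_one, sup_eq_right]
      calc C.act y⁻¹ (C.orbit x) ≤ C.act y⁻¹ (C.orbit y) := ChainAut.monotone _ h
        _ = C.orbit (y * y⁻¹) := (C.orbit_mul _ _).symm
        _ = C.1.cls 1 := by rw [mul_inv_cancel, orbit_one]
    exact fun x y => (le_total (C.orbit x) (C.orbit y)).imp (key x y) (key y x)

theorem mem_toPrimeSubgroup {x : FreeLGroup V G} :
    x ∈ C.toPrimeSubgroup ↔ C.orbit x = C.1.cls 1 := Iff.rfl

theorem toVPreorder_toPrimeSubgroup : C.toPrimeSubgroup.toVPreorder = C := by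
  refine Subtype.ext (SetLike.ext fun a => ?_)
  change a ∈ C.toPrimeSubgroup.toPreCone ↔ _
  rw [PrimeSubgroup.mem_toPreCone, PrimeSubgroup.one_le_iff, mem_toPrimeSubgroup, orbit_inf,
    orbit_one, orbit_eta, inf_eq_right, one_le_cls_iff]

theorem toPrimeSubgroup_toVPreorder (p : PrimeSubgroup (FreeLGroup V G)) :
    p.toVPreorder.toPrimeSubgroup = p := by
  refine SetLike.ext fun x => ?_
  obtain ⟨s, rfl⟩ := mk_surjective x
  rw [mk_eq_eval, mem_toPrimeSubgroup, orbit, act_eval]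
  obtain ⟨c, hc⟩ : ∃ c, p.toPreCone.cls c = s.eval p.toPreCone.rho (p.toPreCone.cls 1) :=
    Quotient.exists_rep _
  obtain ⟨h1, h2⟩ := p.le_of_eval_rho_apply s hc.symm
  rw [map_one, one_mul] at h1 h2
  change s.eval p.toPreCone.rho (p.toPreCone.cls 1) = p.toPreCone.cls 1 ↔ _
  rw [← hc, PrimeSubgroup.toPreCone_cls_eq_iff, map_one, PrimeSubgroup.mem_iff_le]
  exact ⟨fun h => ⟨h1.trans h.1, h.2.trans h2⟩, fun h => ⟨h2.trans h.1, h.2.trans h1⟩⟩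

/-- In a chain, lying strictly below a maximum or a minimum is a disjunction or a conjunction. Since
$\eta(G)$ generates $H$ as a lattice, the claim reduces to the subbasic sets $\mathbb P(a)$. -/
theorem isOpen_lt_orbit (x : FreeLGroup V G) :
    IsOpen {C : VPreorders V G | C.1.cls 1 < C.orbit x} := by
  induction mem_latticeClosure x using latticeClosure_sup_inf_induction with
  | mem _ h =>
    obtain ⟨a, rfl⟩ := h
    have h : {C : VPreorders V G | C.1.cls 1 < C.orbit (eta a)} = basicOpen a := by
      ext C
      change C.1.cls 1 < C.orbit (eta a) ↔ a ∈ C.1 ∧ a⁻¹ ∉ C.1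
      rw [orbit_eta, lt_iff_le_not_ge, one_le_cls_iff, cls_le_one_iff]
    rw [h]
    exact TopologicalSpace.isOpen_generateFrom_of_mem ⟨a, rfl⟩
  | sup x _ y _ hx hy =>
    simp only [orbit_sup, lt_sup_iff, Set.ofPred_or]
    exact hx.union hy
  | inf x _ y _ hx hy =>
    simp only [orbit_inf, lt_inf_iff, Set.ofPred_and]
    exact hx.inter hy

variable (V G) in
/-- The space of right pre-orders of the variety is homeomorphic to the spectrum of the free
ℓ-group. -/
noncomputable def homeomorphSpectrum : VPreorders V G ≃ₜ PrimeSubgroup (FreeLGroup V G) where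
  toFun := toPrimeSubgroup
  invFun := PrimeSubgroup.toVPreorder
  left_inv := toVPreorder_toPrimeSubgroup
  right_inv := toPrimeSubgroup_toVPreorder
  continuous_toFun := by
    refine ⟨?_⟩
    rintro _ ⟨A, rfl⟩
    have : toPrimeSubgroup ⁻¹' PrimeSubgroup.support A =
        ⋃ a ∈ A, {C : VPreorders V G | C.1.cls 1 < C.orbit |a|ₘ} := by
      ext C
      simp only [Set.mem_iUnion, Set.mem_ofPred_eq, exists_prop]
      refine Set.not_subset.trans (exists_congr fun a => and_congr_right fun _ => ?_)
      rw [SetLike.mem_coe, ← PrimeSubgroup.mabs_mem_iff, mem_toPrimeSubgroup]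
      have : C.1.cls 1 ≤ C.orbit |a|ₘ := C.orbit_one ▸ C.orbit_monotone (one_le_mabs a)
      exact ⟨fun h => lt_of_le_of_ne this (Ne.symm h), fun h => h.ne'⟩
    rw [this]
    exact isOpen_biUnion fun a _ => isOpen_lt_orbit _
  continuous_invFun := by
    refine continuous_generateFrom_iff.2 ?_
    rintro _ ⟨a, rfl⟩
    -- $\mathbb P(a)$ corresponds to $\mathfrak p\,\eta(a)>\mathfrak p$, which means that the
    -- positive part of $\eta(a)$ is not in $\mathfrak p$.
    refine ⟨{(eta a : FreeLGroup V G) ⊔ 1}, Set.ext fun p => ?_⟩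
    rw [PrimeSubgroup.mem_support_singleton, ← PrimeSubgroup.le_one_iff]
    have h : a⁻¹ ∈ p.toPreCone ↔ p.Le (eta a) 1 := by
      rw [PrimeSubgroup.mem_toPreCone, ← PrimeSubgroup.mul_right_le_iff (eta a), ← map_mul]
      simp
    change a ∈ p.toPreCone ∧ a⁻¹ ∉ p.toPreCone ↔ _
    rw [h, PrimeSubgroup.mem_toPreCone]
    exact ⟨fun h => h.2, fun h => ⟨(p.le_total _ _).resolve_right h, h⟩⟩

theorem homeomorphSpectrum_image_minimalLayer :
    homeomorphSpectrum V G '' minimalLayer V G = minimalSpectrum (FreeLGroup V G) := by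
  -- Both inclusion orders are specialization orders, so the homeomorphism is an order isomorphism.
  have hle : ∀ C D : VPreorders V G,
      homeomorphSpectrum V G C ≤ homeomorphSpectrum V G D ↔ C ≤ D := fun C D => by
    rw [PrimeSubgroup.le_iff_specializes, le_iff_specializes,
      (homeomorphSpectrum V G).isInducing.specializes_iff]
  let e : VPreorders V G ≃o PrimeSubgroup (FreeLGroup V G) :=
    ⟨(homeomorphSpectrum V G).toEquiv, hle _ _⟩
  ext p
  constructor
  · rintro ⟨C, hC, rfl⟩
    exact e.isMin_apply.2 hC
  · exact fun hp => ⟨e.symm p, e.symm.isMin_apply.2 hp, e.apply_symm_apply p⟩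

end VPreorders

end Spectrum

end OrderedGroups

theorem corollary6p6 (G : Type*) [Group G] [PartialOrder G] [MulLeftMono G] [MulRightMono G]
    (V : OrderedGroups.LVariety) :
    (IsCompact (OrderedGroups.VPreorders.minimalLayer V G) ↔
      OrderedGroups.PrincipalPolarsBoolean (OrderedGroups.FreeLGroup V G)) ∧
    (IsCompact (OrderedGroups.VPreorders.minimalLayer V G) ↔
      IsCompact (OrderedGroups.minimalSpectrum (OrderedGroups.FreeLGroup V G))) ∧
    (IsCompact (OrderedGroups.VPreorders.minimalLayer V G) ↔
      OrderedGroups.PositiveConeComplemented (OrderedGroups.FreeLGroup V G)) := by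
  rw [← (OrderedGroups.VPreorders.homeomorphSpectrum V G).isCompact_image,
    OrderedGroups.VPreorders.homeomorphSpectrum_image_minimalLayer,
    OrderedGroups.principalPolarsBoolean_iff, OrderedGroups.isCompact_minimalSpectrum_iff]
  exact ⟨Iff.rfl, Iff.rfl, Iff.rfl⟩
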